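/- Let $M>0$ and let $j\in(-1,1)$, $j\neq 0$. In the complex Hilbert space $L^2((0,\infty),r\,dr)$ consider the differential expression $$h_0=-\frac{d^2}{dr^2}-\frac1r\frac{d}{dr}+\frac{j^2}{r^2}.$$ For $-\infty<\nu\le\infty$ let $h_{0,\nu}$ be the operator that acts as $h_0$ on the domain of all $\psi\in L^2((0,\infty),r\,dr)$ such that $\psi,\psi'\in AC_{\rm loc}((0,\infty))$, $h_0\psi\in L^2((0,\infty),r\,dr)$, the limits $$\psi_{0,j}=\lim_{r\to0^+}r^{|j|}\psi(r),\qquad \psi_{1,j}=\lim_{r\to0^+}\frac{1}{r^{|j|}}\Big[\psi(r)-\psi_{0,j}\frac1{r^{|j|}}\Big]$$ exist, and $\nu\,\psi_{0,j}=\psi_{1,j}$ (for $\nu=\infty$ this means $\psi_{0,j}=0$). These are the well-known self-adjoint extensions of $h_0$, and $\nu=\infty$ gives the Friedrichs extension. A bound state of energy $E$ is a nonzero $\psi$ in the domain of $h_{0,\nu}$ with $h_{0,\nu}\psi=2ME\,\psi$; here $E\in\mathbb C$ is allowed a priori. (i) If $\nu<0$, then there is exactly one bound state up to a constant factor: the only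 bound state energy is $$E_b=-\frac{2}{M}\left[-\nu\,\frac{\Gamma(1+|j|)}{\Gamma(1-|j|)}\right]^{1/|j|},$$ and the space of $\psi$ in the domain with $h_{0,\nu}\psi=2ME_b\,\psi$ is one-dimensional. (ii) If $0\le\nu\le\infty$, then $h_{0,\nu}$ has no bound state, for any $E\in\mathbb C$. -/

import Mathlib

open MeasureTheory Filter Topology Set

noncomputable section

namespace RadialBG

/-- The measure `r dr` on the half-line `(0, ∞)`. -/
def radialMeasure : Measure ℝ :=
  (volume.restrict (Ioi (0 : ℝ))).withDensity (fun r => ENNReal.ofReal r)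

/-- The Hilbert space `L²((0, ∞), r dr)` of complex-valued functions. -/
abbrev RadialL2 : Type := Lp ℂ 2 radialMeasure

/-- Local absolute continuity on the open half-line `(0, ∞)`. -/
def ACLoc (f : ℝ → ℂ) : Prop :=
  ∀ a b : ℝ, 0 < a → a ≤ b → AbsolutelyContinuousOnInterval f a b

/-- The differential expression `h₀ ψ = -ψ'' - (1/r) ψ' + (j²/r²) ψ`. -/
def radialExpr (j : ℝ) (ψ : ℝ → ℂ) (r : ℝ) : ℂ :=
  -deriv (deriv ψ) r - ((1 / r : ℝ) : ℂ) * deriv ψ r + ((j ^ 2 / r ^ 2 : ℝ) : ℂ) * ψ r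

/-- The maximal domain of `h₀`: functions `ψ ∈ L²(r dr)` with `ψ, ψ' ∈ AC_loc((0, ∞))` and
`h₀ ψ ∈ L²(r dr)`. Values of `ψ` outside `(0, ∞)` are irrelevant. -/
structure InMaximalDomain (j : ℝ) (ψ : ℝ → ℂ) : Prop where
  differentiableAt : ∀ r : ℝ, 0 < r → DifferentiableAt ℝ ψ r
  acLoc : ACLoc ψ
  acLoc_deriv : ACLoc (deriv ψ)
  memLp : MemLp ψ 2 radialMeasure
  memLp_expr : MemLp (radialExpr j ψ) 2 radialMeasure

/-- `c₀ = lim_{r → 0⁺} r^|j| ψ(r)` and `c₁ = lim_{r → 0⁺} r^(-|j|) (ψ(r) - c₀ r^(-|j|))`;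
both limits are required to exist. -/
def HasBoundaryValues (j : ℝ) (ψ : ℝ → ℂ) (c₀ c₁ : ℂ) : Prop :=
  Tendsto (fun r : ℝ => ((r ^ |j| : ℝ) : ℂ) * ψ r) (𝓝[>] 0) (𝓝 c₀) ∧
  Tendsto (fun r : ℝ => ((1 / r ^ |j| : ℝ) : ℂ) * (ψ r - c₀ * ((1 / r ^ |j| : ℝ) : ℂ)))
    (𝓝[>] 0) (𝓝 c₁)

/-- The boundary condition `ν c₀ = c₁` for `-∞ < ν ≤ ∞`; for `ν = ∞` it means `c₀ = 0`. -/
def BoundaryCondition : WithTop ℝ → ℂ → ℂ → Prop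
  | none, c₀, _ => c₀ = 0
  | some ν, c₀, c₁ => (ν : ℂ) * c₀ = c₁

/-- Membership of a function in the domain of `h_{0,ν}`. -/
structure InDomain (j : ℝ) (ν : WithTop ℝ) (ψ : ℝ → ℂ) : Prop
    extends InMaximalDomain j ψ where
  boundary : ∃ c₀ c₁ : ℂ, HasBoundaryValues j ψ c₀ c₁ ∧ BoundaryCondition ν c₀ c₁

theorem ae_radialMeasure_iff {p : ℝ → Prop} :
    (∀ᵐ r ∂radialMeasure, p r) ↔ ∀ᵐ r ∂(volume.restrict (Ioi (0 : ℝ))), p r := by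
  unfold radialMeasure
  rw [ae_withDensity_iff (by fun_prop), ae_restrict_iff' measurableSet_Ioi,
    ae_restrict_iff' measurableSet_Ioi]
  refine eventually_congr (Eventually.of_forall fun r => ?_)
  constructor
  · intro h hr
    exact h hr (by simpa using hr)
  · intro h hr _
    exact h hr

theorem ACLoc.add {f g : ℝ → ℂ} (hf : ACLoc f) (hg : ACLoc g) : ACLoc (f + g) :=
  fun a b ha hab => (hf a b ha hab).add (hg a b ha hab)

theorem ACLoc.smul {f : ℝ → ℂ} (c : ℂ) (hf : ACLoc f) : ACLoc (c • f) :=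
  fun a b ha hab => (hf a b ha hab).const_smul c

theorem ACLoc.congr {f g : ℝ → ℂ} (hf : ACLoc f) (h : ∀ r : ℝ, 0 < r → f r = g r) :
    ACLoc g := by
  intro a b ha hab
  have hfa := hf a b ha hab
  rw [absolutelyContinuousOnInterval_iff] at hfa ⊢
  intro ε hε
  obtain ⟨δ, hδ, H⟩ := hfa ε hε
  refine ⟨δ, hδ, fun E hE hlen => ?_⟩
  have hpos : ∀ x ∈ uIcc a b, 0 < x := by
    intro x hx
    rw [uIcc_of_le hab] at hx
    exact lt_of_lt_of_le ha hx.1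
  have := H E hE hlen
  rw [show (∑ i ∈ Finset.range E.1, dist (g (E.2 i).1) (g (E.2 i).2)) =
    ∑ i ∈ Finset.range E.1, dist (f (E.2 i).1) (f (E.2 i).2) from
      Finset.sum_congr rfl fun i hi => by
        rw [h _ (hpos _ (hE.1 i hi).1), h _ (hpos _ (hE.1 i hi).2)]]
  exact this

/-- A locally absolutely continuous function is differentiable almost everywhere. -/
theorem ACLoc.ae_differentiableAt {f : ℝ → ℂ} (hf : ACLoc f) :
    ∀ᵐ r ∂radialMeasure, DifferentiableAt ℝ f r := by
  rw [ae_radialMeasure_iff, ae_restrict_iff' measurableSet_Ioi]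
  have key : ∀ n : ℕ, ∀ᵐ r : ℝ, r ∈ Ioo (1 / ((n : ℝ) + 1)) ((n : ℝ) + 2) →
      DifferentiableAt ℝ f r := by
    intro n
    have hn : (0 : ℝ) < 1 / ((n : ℝ) + 1) := by positivity
    have hle : 1 / ((n : ℝ) + 1) ≤ (n : ℝ) + 2 := by
      rw [div_le_iff₀ (by positivity)]
      nlinarith [Nat.cast_nonneg (α := ℝ) n]
    have hbv := (hf _ _ hn hle).boundedVariationOn
    filter_upwards [hbv.locallyBoundedVariationOn.ae_differentiableWithinAt_of_mem]
      with r hr hmem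
    have hI : uIcc (1 / ((n : ℝ) + 1)) ((n : ℝ) + 2) ∈ 𝓝 r := by
      rw [uIcc_of_le hle]
      exact Icc_mem_nhds hmem.1 hmem.2
    exact (hr (mem_of_mem_nhds hI)).differentiableAt hI
  filter_upwards [ae_all_iff.2 key] with r hr hr0
  have hr0' : (0 : ℝ) < r := hr0
  obtain ⟨n, hn⟩ := exists_nat_gt (max r (1 / r))
  refine hr n ⟨?_, ?_⟩
  · rw [div_lt_comm₀ (by positivity) hr0']
    have := le_max_right r (1 / r)
    linarith
  · have := le_max_left r (1 / r)
    linarith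

theorem deriv_congr_pos {f g : ℝ → ℂ} (h : ∀ r : ℝ, 0 < r → f r = g r) :
    ∀ r : ℝ, 0 < r → deriv f r = deriv g r := by
  intro r hr
  apply Filter.EventuallyEq.deriv_eq
  filter_upwards [Ioi_mem_nhds hr] with x hx using h x hx

theorem radialExpr_congr (j : ℝ) {f g : ℝ → ℂ} (h : ∀ r : ℝ, 0 < r → f r = g r) :
    radialExpr j f =ᵐ[radialMeasure] radialExpr j g := by
  refine ae_radialMeasure_iff.2 ((ae_restrict_iff' measurableSet_Ioi).2
    (Eventually.of_forall fun r hr => ?_))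
  simp only [radialExpr, h r hr, deriv_congr_pos h r hr,
    deriv_congr_pos (deriv_congr_pos h) r hr]

theorem InMaximalDomain.eq_of_ae_eq {j : ℝ} {f g : ℝ → ℂ} (hf : InMaximalDomain j f)
    (hg : InMaximalDomain j g) (h : f =ᵐ[radialMeasure] g) :
    ∀ r : ℝ, 0 < r → f r = g r := by
  have h' : f =ᵐ[volume.restrict (Ioi (0 : ℝ))] g := ae_radialMeasure_iff.1 h
  have := Measure.eqOn_open_of_ae_eq h' isOpen_Ioi
    (fun r hr => (hf.differentiableAt r hr).continuousAt.continuousWithinAt)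
    (fun r hr => (hg.differentiableAt r hr).continuousAt.continuousWithinAt)
  exact fun r hr => this hr

theorem InMaximalDomain.deriv_add {j : ℝ} {f g : ℝ → ℂ} (hf : InMaximalDomain j f)
    (hg : InMaximalDomain j g) :
    ∀ r : ℝ, 0 < r → (deriv f + deriv g) r = deriv (f + g) r := fun r hr =>
  (_root_.deriv_add (hf.differentiableAt r hr) (hg.differentiableAt r hr)).symm

theorem InMaximalDomain.deriv_smul {j : ℝ} {f : ℝ → ℂ} (hf : InMaximalDomain j f) (c : ℂ) :
    ∀ r : ℝ, 0 < r → (c • deriv f) r = deriv (c • f) r := fun r hr =>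
  (deriv_const_smul c (hf.differentiableAt r hr)).symm

theorem radialExpr_add {j : ℝ} {f g : ℝ → ℂ} (hf : InMaximalDomain j f)
    (hg : InMaximalDomain j g) :
    radialExpr j (f + g) =ᵐ[radialMeasure] radialExpr j f + radialExpr j g := by
  have hpos : ∀ᵐ r ∂radialMeasure, (0 : ℝ) < r :=
    ae_radialMeasure_iff.2 (ae_restrict_mem measurableSet_Ioi)
  filter_upwards [hpos, hf.acLoc_deriv.ae_differentiableAt,
    hg.acLoc_deriv.ae_differentiableAt] with r hr h1 h2
  have e1 := hf.deriv_add hg r hr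
  have e2 := deriv_congr_pos (hf.deriv_add hg) r hr
  rw [_root_.deriv_add h1 h2] at e2
  simp only [Pi.add_apply] at e1
  simp only [radialExpr, Pi.add_apply, ← e1, ← e2]
  ring

theorem radialExpr_smul {j : ℝ} {f : ℝ → ℂ} (hf : InMaximalDomain j f) (c : ℂ) :
    radialExpr j (c • f) =ᵐ[radialMeasure] c • radialExpr j f := by
  have hpos : ∀ᵐ r ∂radialMeasure, (0 : ℝ) < r :=
    ae_radialMeasure_iff.2 (ae_restrict_mem measurableSet_Ioi)
  filter_upwards [hpos, hf.acLoc_deriv.ae_differentiableAt] with r hr h1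
  have e1 := hf.deriv_smul c r hr
  have e2 := deriv_congr_pos (hf.deriv_smul c) r hr
  rw [deriv_const_smul c h1] at e2
  simp only [Pi.smul_apply, smul_eq_mul] at e1 e2
  simp only [radialExpr, Pi.smul_apply, smul_eq_mul, ← e1, ← e2]
  ring

theorem HasBoundaryValues.add {j : ℝ} {f g : ℝ → ℂ} {a₀ a₁ b₀ b₁ : ℂ}
    (hf : HasBoundaryValues j f a₀ a₁) (hg : HasBoundaryValues j g b₀ b₁) :
    HasBoundaryValues j (f + g) (a₀ + b₀) (a₁ + b₁) := by
  refine ⟨(hf.1.add hg.1).congr fun r => ?_, (hf.2.add hg.2).congr fun r => ?_⟩ <;>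
  · simp only [Pi.add_apply]
    ring

theorem HasBoundaryValues.smul {j : ℝ} {f : ℝ → ℂ} {a₀ a₁ : ℂ} (c : ℂ)
    (hf : HasBoundaryValues j f a₀ a₁) :
    HasBoundaryValues j (c • f) (c * a₀) (c * a₁) := by
  refine ⟨(hf.1.const_mul c).congr fun r => ?_, (hf.2.const_mul c).congr fun r => ?_⟩ <;>
  · simp only [Pi.smul_apply, smul_eq_mul]
    ring

theorem InDomain.add {j : ℝ} {ν : WithTop ℝ} {f g : ℝ → ℂ} (hf : InDomain j ν f)
    (hg : InDomain j ν g) : InDomain j ν (f + g) where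
  differentiableAt r hr := (hf.differentiableAt r hr).add (hg.differentiableAt r hr)
  acLoc := hf.acLoc.add hg.acLoc
  acLoc_deriv := (hf.acLoc_deriv.add hg.acLoc_deriv).congr
    (hf.toInMaximalDomain.deriv_add hg.toInMaximalDomain)
  memLp := hf.memLp.add hg.memLp
  memLp_expr := (memLp_congr_ae
    (radialExpr_add hf.toInMaximalDomain hg.toInMaximalDomain)).2
      (hf.memLp_expr.add hg.memLp_expr)
  boundary := by
    obtain ⟨a₀, a₁, ha, hab⟩ := hf.boundary
    obtain ⟨b₀, b₁, hb, hbb⟩ := hg.boundary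
    refine ⟨_, _, ha.add hb, ?_⟩
    cases ν with
    | top =>
      change a₀ = 0 at hab
      change b₀ = 0 at hbb
      change a₀ + b₀ = 0
      rw [hab, hbb, add_zero]
    | coe ν =>
      change (ν : ℂ) * a₀ = a₁ at hab
      change (ν : ℂ) * b₀ = b₁ at hbb
      change (ν : ℂ) * (a₀ + b₀) = a₁ + b₁
      rw [← hab, ← hbb, mul_add]

theorem InDomain.smul {j : ℝ} {ν : WithTop ℝ} {f : ℝ → ℂ} (c : ℂ) (hf : InDomain j ν f) :
    InDomain j ν (c • f) where
  differentiableAt r hr := (hf.differentiableAt r hr).const_smul c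
  acLoc := hf.acLoc.smul c
  acLoc_deriv := (hf.acLoc_deriv.smul c).congr (hf.toInMaximalDomain.deriv_smul c)
  memLp := hf.memLp.const_smul c
  memLp_expr := (memLp_congr_ae (radialExpr_smul hf.toInMaximalDomain c)).2
    (hf.memLp_expr.const_smul c)
  boundary := by
    obtain ⟨a₀, a₁, ha, hab⟩ := hf.boundary
    refine ⟨_, _, ha.smul c, ?_⟩
    cases ν with
    | top =>
      change a₀ = 0 at hab
      change c * a₀ = 0
      rw [hab, mul_zero]
    | coe ν =>
      change (ν : ℂ) * a₀ = a₁ at hab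
      change (ν : ℂ) * (c * a₀) = c * a₁
      rw [← hab]
      ring

theorem InDomain.zero (j : ℝ) (ν : WithTop ℝ) : InDomain j ν 0 := by
  have h0 : radialExpr j 0 = 0 := by
    funext r
    simp only [radialExpr, Pi.zero_def, deriv_const']
    simp
  have hac : ACLoc (0 : ℝ → ℂ) := fun a b _ _ =>
    (contDiff_const (c := (0 : ℂ)) (n := 1)).contDiffOn.absolutelyContinuousOnInterval
  refine ⟨⟨fun r _ => differentiableAt_const 0, hac, ?_, MemLp.zero, ?_⟩, 0, 0, ?_, ?_⟩
  · simpa only [Pi.zero_def, deriv_const'] using hac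
  · rw [h0]
    exact MemLp.zero
  · simp [HasBoundaryValues]
  · cases ν with
    | top => exact rfl
    | coe ν => exact mul_zero _

/-- The domain of `h_{0,ν}` as a subspace of `L²((0, ∞), r dr)`. -/
def extensionDomain (j : ℝ) (ν : WithTop ℝ) : Submodule ℂ RadialL2 where
  carrier := {f | ∃ ψ : ℝ → ℂ, InDomain j ν ψ ∧ f =ᵐ[radialMeasure] ψ}
  add_mem' := by
    rintro f g ⟨φ, hφ, hfφ⟩ ⟨ψ, hψ, hgψ⟩
    exact ⟨φ + ψ, hφ.add hψ, (Lp.coeFn_add f g).trans (hfφ.add hgψ)⟩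
  zero_mem' := ⟨0, InDomain.zero j ν, Lp.coeFn_zero ℂ 2 radialMeasure⟩
  smul_mem' := by
    rintro c f ⟨φ, hφ, hfφ⟩
    exact ⟨c • φ, hφ.smul c, (Lp.coeFn_smul c f).trans (hfφ.const_smul c)⟩

/-- The representative of a domain element that is continuously differentiable on `(0, ∞)`. -/
def rep {j : ℝ} {ν : WithTop ℝ} (f : extensionDomain j ν) : ℝ → ℂ := Classical.choose f.2

theorem rep_inDomain {j : ℝ} {ν : WithTop ℝ} (f : extensionDomain j ν) :
    InDomain j ν (rep f) := (Classical.choose_spec f.2).1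

theorem coeFn_ae_eq_rep {j : ℝ} {ν : WithTop ℝ} (f : extensionDomain j ν) :
    (f : RadialL2) =ᵐ[radialMeasure] rep f := (Classical.choose_spec f.2).2

theorem radialExpr_rep_ae_eq {j : ℝ} {ν : WithTop ℝ} (f : extensionDomain j ν) {ψ : ℝ → ℂ}
    (hψ : InDomain j ν ψ) (h : (f : RadialL2) =ᵐ[radialMeasure] ψ) :
    radialExpr j (rep f) =ᵐ[radialMeasure] radialExpr j ψ :=
  radialExpr_congr j ((rep_inDomain f).toInMaximalDomain.eq_of_ae_eq hψ.toInMaximalDomain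
    ((coeFn_ae_eq_rep f).symm.trans h))

/-- The operator `h_{0,ν}` in `L²((0, ∞), r dr)`: it acts as `h₀` on the functions of the
maximal domain that satisfy `ν ψ_{0,j} = ψ_{1,j}`. -/
def extension (j : ℝ) (ν : WithTop ℝ) : RadialL2 →ₗ.[ℂ] RadialL2 where
  domain := extensionDomain j ν
  toFun :=
    { toFun := fun f => (rep_inDomain f).memLp_expr.toLp (radialExpr j (rep f))
      map_add' := by
        intro f g
        rw [← MemLp.toLp_add]
        refine MemLp.toLp_congr _ _ ?_
        exact (radialExpr_rep_ae_eq (f + g) ((rep_inDomain f).add (rep_inDomain g))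
          ((Lp.coeFn_add (f : RadialL2) g).trans
            ((coeFn_ae_eq_rep f).add (coeFn_ae_eq_rep g)))).trans
          (radialExpr_add (rep_inDomain f).toInMaximalDomain
            (rep_inDomain g).toInMaximalDomain)
      map_smul' := by
        intro c f
        rw [RingHom.id_apply, ← MemLp.toLp_const_smul]
        refine MemLp.toLp_congr _ _ ?_
        exact (radialExpr_rep_ae_eq (c • f) ((rep_inDomain f).smul c)
          ((Lp.coeFn_smul c (f : RadialL2)).trans ((coeFn_ae_eq_rep f).const_smul c))).trans
          (radialExpr_smul (rep_inDomain f).toInMaximalDomain c) }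

/-- The space of solutions `ψ` in the domain of `h_{0,ν}` of `h_{0,ν} ψ = k² ψ`, where
`k² = 2 M E`. -/
def boundStateSpace (M j : ℝ) (ν : WithTop ℝ) (E : ℂ) : Submodule ℂ RadialL2 :=
  (LinearMap.ker ((extension j ν).toFun -
    (2 * (M : ℂ) * E) • (extension j ν).domain.subtype)).map (extension j ν).domain.subtype

/-- The bound state energies: those `E` for which `h_{0,ν} ψ = 2 M E ψ` has a nonzero
square-integrable solution in the domain of `h_{0,ν}`. -/
def boundStateEnergies (M j : ℝ) (ν : WithTop ℝ) : Set ℂ :=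
  {E | boundStateSpace M j ν E ≠ ⊥}

end RadialBG

end

/-!
A bound state is a square-integrable solution of `-ψ'' - ψ'/r + (α²/r²) ψ = lam ψ` with `α = |j|`
and `lam = 2 M E`. Since `ψ'` is locally absolutely continuous, the equation holds classically
(`InMaximalDomain.isRadialSolution`), and it is studied as a first-order system for `ψ` and the
flux `u = r ψ'`. No Bessel asymptotics at infinity and no general solution near `0` are needed;
everything rests on monotone quantities and on one fact about infinity. If `ψ ∈ L²(r dr)`, then
also `ψ' ∈ L²(r dr)` near infinity, so expressions such as `ψ v - φ u` and `conj ψ · u` cannot stay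
away from `0` there (`IsRadialSolution.not_le_norm_mul_norm_flux`).

* `lam` not real: `Im (conj ψ · u)` is monotone, it tends to `0` at the origin because the boundary
  condition is real (`tendsto_flux_of_hasBoundaryValues`), and it does not stay away from `0` at
  infinity, so `ψ = 0` (`eq_zero_of_im_ne_zero`).
* `lam > 0`: `|u|² + (lam r² - α²) |ψ|²` is nondecreasing, which excludes square-integrable
  solutions whatever the boundary condition (`eq_zero_of_pos`).
* `lam = 0`: the solutions are combinations of `r^α` and `r^(-α)`, and since `α < 1` no nonzero one
  is in `L²(r dr)` at infinity (`eq_zero_of_zero`).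
* `lam = -m < 0`: there is one positive square-integrable solution,
  `r^(-α) ∫₀^∞ t^(α-1) exp(-t - m r²/(4t)) dt`, a multiple of `K_α(√m r)`. Its Wronskian with any
  other square-integrable solution is constant, hence `0`, so the bound states are its multiples
  (`exists_of_mem_boundStateSpace`). Its boundary values are `ψ₀ = Γ(α)` and
  `ψ₁ = -(m/4)^α Γ(1-α)/α`, so the boundary condition reads
  `(m/4)^α = -ν Γ(1+α)/Γ(1-α)`. This has exactly one solution `m > 0` if `ν < 0` and none if
  `0 ≤ ν ≤ ∞`.
-/

namespace RadialBG

/-! ### A modified Bessel integral -/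

/-- The integrand `t^(s-1) exp(-t - y/t)` of `besselIntegral`. -/
noncomputable def besselIntegrand (s y t : ℝ) : ℝ := t ^ (s - 1) * Real.exp (-t - y / t)

/-- The integral `∫₀^∞ t^(s-1) exp(-t - y/t) dt`. For `y > 0` it equals `2 y^(s/2) K_s(2 √y)`,
where `K_s` is the modified Bessel function of the second kind. -/
noncomputable def besselIntegral (s y : ℝ) : ℝ := ∫ t in Ioi (0 : ℝ), besselIntegrand s y t

theorem besselIntegrand_pos (s y : ℝ) {t : ℝ} (ht : 0 < t) : 0 < besselIntegrand s y t :=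
  mul_pos (Real.rpow_pos_of_pos ht _) (Real.exp_pos _)

theorem continuousOn_besselIntegrand (s y : ℝ) :
    ContinuousOn (besselIntegrand s y) (Ioi 0) := by
  intro t ht
  have ht' : t ≠ 0 := ne_of_gt ht
  refine ContinuousAt.continuousWithinAt ?_
  unfold besselIntegrand
  exact (Real.continuousAt_rpow_const _ _ (Or.inl ht')).mul
    ((continuousAt_id.neg.sub (continuousAt_const.div continuousAt_id ht')).rexp)

theorem aestronglyMeasurable_besselIntegrand (s y : ℝ) :
    AEStronglyMeasurable (besselIntegrand s y) (volume.restrict (Ioi 0)) :=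
  (continuousOn_besselIntegrand s y).aestronglyMeasurable measurableSet_Ioi

/-- The factor `exp(-y/t)` gains any number `n` of powers of `t` at `t = 0`; this makes the
integral converge for every real `s`, and uniformly for `y ≥ y₀ > 0`. -/
theorem besselIntegrand_le {s y₀ y t : ℝ} (hy₀ : 0 < y₀) (hy : y₀ ≤ y) (ht : 0 < t) (n : ℕ) :
    besselIntegrand s y t ≤
      (n.factorial / y₀ ^ n) * (Real.exp (-t) * t ^ (s + n - 1)) := by
  have h1 : (y₀ / t) ^ n / n.factorial ≤ Real.exp (y / t) :=
    (Real.pow_div_factorial_le_exp _ (by positivity) n).trans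
      (Real.exp_le_exp.2 (by gcongr))
  have h2 : Real.exp (-(y / t)) ≤ n.factorial / y₀ ^ n * t ^ n := by
    rw [Real.exp_neg]
    calc (Real.exp (y / t))⁻¹ ≤ ((y₀ / t) ^ n / n.factorial)⁻¹ := by gcongr
      _ = n.factorial / y₀ ^ n * t ^ n := by rw [div_pow]; field_simp
  have h3 : t ^ (s + n - 1) = t ^ (s - 1) * t ^ n := by
    rw [← Real.rpow_natCast t n, ← Real.rpow_add ht]; ring_nf
  calc besselIntegrand s y t = t ^ (s - 1) * Real.exp (-t) * Real.exp (-(y / t)) := by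
        rw [besselIntegrand, sub_eq_add_neg (-t), Real.exp_add]; ring
    _ ≤ t ^ (s - 1) * Real.exp (-t) * (n.factorial / y₀ ^ n * t ^ n) := by gcongr
    _ = _ := by rw [h3]; ring

theorem integrableOn_besselIntegrand (s : ℝ) {y : ℝ} (hy : 0 < y) :
    IntegrableOn (besselIntegrand s y) (Ioi 0) := by
  obtain ⟨n, hn⟩ := exists_nat_gt (-s)
  refine Integrable.mono'
    ((Real.GammaIntegral_convergent (s := s + n) (by linarith)).const_mul
      (n.factorial / y ^ n))
    (aestronglyMeasurable_besselIntegrand s y) ?_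
  filter_upwards [ae_restrict_mem measurableSet_Ioi] with t ht
  rw [Real.norm_of_nonneg (besselIntegrand_pos s y ht).le]
  exact besselIntegrand_le hy le_rfl ht n

theorem besselIntegral_pos (s : ℝ) {y : ℝ} (hy : 0 < y) : 0 < besselIntegral s y := by
  refine (setIntegral_pos_iff_support_of_nonneg_ae ?_ (integrableOn_besselIntegrand s hy)).2 ?_
  · filter_upwards [ae_restrict_mem measurableSet_Ioi] with t ht
    exact (besselIntegrand_pos s y ht).le
  · rw [inter_eq_self_of_subset_right
      (show Ioi (0 : ℝ) ⊆ Function.support (besselIntegrand s y) from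
        fun t ht => (besselIntegrand_pos s y ht).ne')]
    simp

/-- For `n = 0` a bound near `y = 0` (if `s > 0`), for larger `n` decay of order `y^(-n)`. -/
theorem besselIntegral_le {s y : ℝ} (hy : 0 < y) (n : ℕ) (hs : 0 < s + n) :
    besselIntegral s y ≤ n.factorial / y ^ n * Real.Gamma (s + n) := by
  rw [Real.Gamma_eq_integral hs, ← integral_const_mul]
  exact setIntegral_mono_on (integrableOn_besselIntegrand s hy)
    ((Real.GammaIntegral_convergent hs).const_mul _) measurableSet_Ioi
    fun t ht => besselIntegrand_le hy le_rfl ht n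

theorem hasDerivAt_besselIntegral (s : ℝ) {y : ℝ} (hy : 0 < y) :
    HasDerivAt (besselIntegral s) (-besselIntegral (s - 1) y) y := by
  obtain ⟨n, hn⟩ := exists_nat_gt (-(s - 1))
  have h := (hasDerivAt_integral_of_dominated_loc_of_deriv_le
    (μ := volume.restrict (Ioi (0 : ℝ))) (F := besselIntegrand s)
    (F' := fun y t => -besselIntegrand (s - 1) y t) (x₀ := y) (s := Ioi (y / 2))
    (bound := fun t => (n.factorial / (y / 2) ^ n) * (Real.exp (-t) * t ^ (s - 1 + n - 1)))
    (Ioi_mem_nhds (by linarith))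
    (Eventually.of_forall fun y => aestronglyMeasurable_besselIntegrand s y)
    (integrableOn_besselIntegrand s hy)
    (aestronglyMeasurable_besselIntegrand (s - 1) y).neg ?_
    ((Real.GammaIntegral_convergent (s := s - 1 + n) (by linarith)).const_mul _) ?_).2
  · rw [integral_neg] at h
    exact h
  · filter_upwards [ae_restrict_mem measurableSet_Ioi] with t ht x hx
    rw [norm_neg, Real.norm_of_nonneg (besselIntegrand_pos _ x ht).le]
    exact besselIntegrand_le (by linarith) (le_of_lt hx) ht n
  · filter_upwards [ae_restrict_mem measurableSet_Ioi] with t ht x _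
    have ht' : (0 : ℝ) < t := ht
    have h1 : HasDerivAt (fun x : ℝ => -t - x / t) (-(1 / t)) x :=
      ((hasDerivAt_id x).div_const t).const_sub (-t)
    refine (h1.exp.const_mul (t ^ (s - 1))).congr_deriv ?_
    rw [besselIntegrand, Real.rpow_sub_one ht'.ne' (s - 1)]
    field_simp

/-- The three-term recurrence, obtained by integrating the derivative of `t^s exp(-t - y/t)`. -/
theorem besselIntegral_recurrence (s : ℝ) {y : ℝ} (hy : 0 < y) :
    y * besselIntegral (s - 1) y = besselIntegral (s + 1) y - s * besselIntegral s y := by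
  have hi := (integrableOn_besselIntegrand s hy).const_mul s
  have hi1 := integrableOn_besselIntegrand (s + 1) hy
  have hi2 := (integrableOn_besselIntegrand (s - 1) hy).const_mul y
  have hsum := (hi.sub hi1).add hi2
  have hd : ∀ t ∈ Ioi (0 : ℝ), HasDerivAt (besselIntegrand (s + 1) y)
      (s * besselIntegrand s y t - besselIntegrand (s + 1) y t
        + y * besselIntegrand (s - 1) y t) t := by
    intro t ht
    have ht' : (0 : ℝ) < t := ht
    have h1 : HasDerivAt (fun t : ℝ => -t - y / t) (-1 + y / t ^ 2) t := by
      have := (hasDerivAt_id t).neg.sub ((hasDerivAt_inv ht'.ne').const_mul y)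
      refine (this.congr_deriv ?_)
      field_simp
      ring
    have h2 := (Real.hasDerivAt_rpow_const (p := s + 1 - 1) (Or.inl ht'.ne')).mul h1.exp
    refine h2.congr_deriv ?_
    simp only [besselIntegrand, Real.rpow_sub_one ht'.ne', Real.rpow_add_one ht'.ne']
    field_simp
    ring
  have hinf : Tendsto (besselIntegrand (s + 1) y) atTop (𝓝 0) :=
    tendsto_zero_of_hasDerivAt_of_integrableOn_Ioi hd hsum hi1
  have hzero : Tendsto (besselIntegrand (s + 1) y) (𝓝[>] 0) (𝓝 0) := by
    obtain ⟨n, hn⟩ := exists_nat_gt (-s)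
    have hb : Tendsto (fun t : ℝ => (n.factorial / y ^ n) *
        (Real.exp (-t) * t ^ (s + 1 + n - 1))) (𝓝[>] 0) (𝓝 0) := by
      have hp : 0 < s + 1 + n - 1 := by linarith
      have hc : ContinuousAt (fun t : ℝ => (n.factorial / y ^ n) *
          (Real.exp (-t) * t ^ (s + 1 + n - 1))) 0 :=
        continuousAt_const.mul ((continuous_neg.rexp.continuousAt).mul
          (Real.continuousAt_rpow_const _ _ (Or.inr hp.le)))
      have := hc.tendsto.mono_left (nhdsWithin_le_nhds (s := Ioi 0))
      simpa [Real.zero_rpow hp.ne'] using this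
    refine squeeze_zero' ?_ ?_ hb
    · filter_upwards [self_mem_nhdsWithin] with t ht using (besselIntegrand_pos _ y ht).le
    · filter_upwards [self_mem_nhdsWithin] with t ht using besselIntegrand_le hy le_rfl ht n
  have key := integral_Ioi_deriv_mul_eq_sub (a := 0) (u := besselIntegrand (s + 1) y)
    (v := fun _ => (1 : ℝ)) (v' := fun _ => 0) (a' := 0) (b' := 0) hd
    (fun x _ => hasDerivAt_const x 1)
    (IntegrableOn.congr_fun hsum (fun t _ => by simp) measurableSet_Ioi)
    (by simpa [Pi.mul_def] using hzero) (by simpa [Pi.mul_def] using hinf)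
  simp only [mul_one, mul_zero, add_zero, sub_zero] at key
  have e := integral_add (hi.sub hi1) hi2
  simp only [Pi.sub_apply] at e
  rw [e, integral_sub hi hi1, integral_const_mul, integral_const_mul] at key
  simp only [besselIntegral]
  linarith

/-- The substitution `t ↦ y/t`. -/
theorem rpow_mul_besselIntegral_neg (s : ℝ) {y : ℝ} (hy : 0 < y) :
    y ^ s * besselIntegral (-s) y = besselIntegral s y := by
  have h1 := integral_comp_mul_left_Ioi' (besselIntegrand (-s) y) 0 hy
  rw [mul_zero, ← integral_comp_rpow_Ioi _ (by norm_num : (-1 : ℝ) ≠ 0)] at h1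
  rw [besselIntegral, ← h1, besselIntegral, smul_eq_mul, ← mul_assoc, ← integral_const_mul]
  refine setIntegral_congr_fun measurableSet_Ioi fun t ht => ?_
  have ht' : (0 : ℝ) < t := ht
  have e1 : y * t ^ (-1 : ℝ) = y / t := by rw [Real.rpow_neg_one]; rfl
  have e2 : y / (y / t) = t := by field_simp
  have e3 : (y / t) ^ (-s - 1) = y ^ (-s) * y⁻¹ * (t ^ s * t) := by
    rw [Real.div_rpow hy.le ht'.le, Real.rpow_sub_one hy.ne', Real.rpow_sub_one ht'.ne',
      Real.rpow_neg ht'.le]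
    field_simp
  have e4 : t ^ (-1 - 1 : ℝ) = (t * t)⁻¹ := by
    rw [Real.rpow_sub_one ht'.ne', Real.rpow_neg_one]; field_simp
  simp only [besselIntegrand, e1, e2, e3, e4, smul_eq_mul, abs_neg, abs_one, one_mul]
  rw [show -(y / t) - t = -t - y / t by ring, Real.rpow_neg hy.le, Real.rpow_sub_one ht'.ne']
  have := (Real.rpow_pos_of_pos hy s).ne'
  field_simp

theorem tendsto_besselIntegral_zero {s : ℝ} (hs : 0 < s) :
    Tendsto (besselIntegral s) (𝓝[>] 0) (𝓝 (Real.Gamma s)) := by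
  rw [Real.Gamma_eq_integral hs]
  refine tendsto_integral_filter_of_dominated_convergence
    (fun t => Real.exp (-t) * t ^ (s - 1))
    (Eventually.of_forall fun y => aestronglyMeasurable_besselIntegrand s y) ?_
    (Real.GammaIntegral_convergent hs) ?_
  · filter_upwards [self_mem_nhdsWithin] with y hy
    filter_upwards [ae_restrict_mem measurableSet_Ioi] with t ht
    rw [Real.norm_of_nonneg (besselIntegrand_pos s y ht).le]
    simpa using besselIntegrand_le (s := s) hy le_rfl ht 0
  · filter_upwards [ae_restrict_mem measurableSet_Ioi] with t ht
    have : ContinuousAt (fun y => besselIntegrand s y t) 0 := by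
      unfold besselIntegrand
      fun_prop
    have h := this.tendsto.mono_left (nhdsWithin_le_nhds (s := Ioi 0))
    simpa [besselIntegrand, mul_comm] using h

/-! ### The radial equation as a first-order system -/

/-- A solution of `-ψ'' - ψ'/r + (α²/r²) ψ = lam ψ` on `(0, ∞)`, written as a first-order system
in `ψ` and the flux `u = r ψ'`. Values outside `(0, ∞)` are irrelevant. -/
structure IsRadialSolution (α : ℝ) (lam : ℂ) (ψ u : ℝ → ℂ) : Prop where
  hasDerivAt : ∀ r : ℝ, 0 < r → HasDerivAt ψ (u r / (r : ℂ)) r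
  hasDerivAt_flux : ∀ r : ℝ, 0 < r →
    HasDerivAt u (((α : ℂ) ^ 2 / (r : ℂ) - lam * (r : ℂ)) * ψ r) r

theorem norm_sq_eq_re_im (z : ℂ) : ‖z‖ ^ 2 = z.re * z.re + z.im * z.im := by
  rw [Complex.sq_norm, Complex.normSq_apply]

theorem _root_.HasDerivAt.complex_re {f : ℝ → ℂ} {f' : ℂ} {r : ℝ} (h : HasDerivAt f f' r) :
    HasDerivAt (fun r => (f r).re) f'.re r :=
  Complex.reCLM.hasFDerivAt.comp_hasDerivAt r h

theorem _root_.HasDerivAt.complex_im {f : ℝ → ℂ} {f' : ℂ} {r : ℝ} (h : HasDerivAt f f' r) :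
    HasDerivAt (fun r => (f r).im) f'.im r :=
  Complex.imCLM.hasFDerivAt.comp_hasDerivAt r h

/-- A function that is at least `c / r` near infinity, `c > 0`, is not integrable there. -/
theorem not_integrableOn_of_le_mul {f : ℝ → ℝ} {a R c : ℝ} (hc : 0 < c)
    (h : ∀ r : ℝ, R < r → c ≤ r * f r) : ¬ IntegrableOn f (Ioi a) := by
  intro hf
  set T := max (max a R) 1
  have hT : 0 < T := lt_of_lt_of_le one_pos (le_max_right _ _)
  refine not_integrableOn_Ioi_inv (a := T) (Integrable.mono' (g := fun r => c⁻¹ * f r)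
    ((hf.mono_set (Ioi_subset_Ioi ((le_max_left _ _).trans (le_max_left _ _)))).const_mul _)
    (by fun_prop) ?_)
  filter_upwards [ae_restrict_mem measurableSet_Ioi] with r hr
  have hr' : T < r := hr
  have hr0 : 0 < r := hT.trans hr'
  have := h r (lt_of_le_of_lt ((le_max_right a R).trans (le_max_left _ _)) hr')
  rw [norm_inv, Real.norm_of_nonneg hr0.le, inv_mul_eq_div, le_div_iff₀ hc,
    inv_mul_le_iff₀ hr0]
  exact this

namespace IsRadialSolution

variable {α : ℝ} {lam : ℂ} {ψ u φ v : ℝ → ℂ}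

theorem continuousOn (h : IsRadialSolution α lam ψ u) : ContinuousOn ψ (Ioi 0) :=
  fun r hr => (h.hasDerivAt r hr).continuousAt.continuousWithinAt

theorem continuousOn_flux (h : IsRadialSolution α lam ψ u) : ContinuousOn u (Ioi 0) :=
  fun r hr => (h.hasDerivAt_flux r hr).continuousAt.continuousWithinAt

theorem hasDerivAt_re (h : IsRadialSolution α lam ψ u) {r : ℝ} (hr : 0 < r) :
    HasDerivAt (fun r => (ψ r).re) ((u r).re / r) r := by
  simpa using (h.hasDerivAt r hr).complex_re

theorem hasDerivAt_im (h : IsRadialSolution α lam ψ u) {r : ℝ} (hr : 0 < r) :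
    HasDerivAt (fun r => (ψ r).im) ((u r).im / r) r := by
  simpa using (h.hasDerivAt r hr).complex_im

theorem hasDerivAt_flux_re (h : IsRadialSolution α lam ψ u) {r : ℝ} (hr : 0 < r) :
    HasDerivAt (fun r => (u r).re)
      ((α ^ 2 / r - lam.re * r) * (ψ r).re + lam.im * r * (ψ r).im) r := by
  refine (h.hasDerivAt_flux r hr).complex_re.congr_deriv ?_
  rw [show (α : ℂ) ^ 2 / (r : ℂ) = ((α ^ 2 / r : ℝ) : ℂ) by push_cast; rfl]
  simp only [Complex.mul_re, Complex.sub_re, Complex.sub_im, Complex.mul_im, Complex.ofReal_re,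
    Complex.ofReal_im]
  ring

theorem hasDerivAt_flux_im (h : IsRadialSolution α lam ψ u) {r : ℝ} (hr : 0 < r) :
    HasDerivAt (fun r => (u r).im)
      ((α ^ 2 / r - lam.re * r) * (ψ r).im - lam.im * r * (ψ r).re) r := by
  refine (h.hasDerivAt_flux r hr).complex_im.congr_deriv ?_
  rw [show (α : ℂ) ^ 2 / (r : ℂ) = ((α ^ 2 / r : ℝ) : ℂ) by push_cast; rfl]
  simp only [Complex.mul_re, Complex.sub_re, Complex.sub_im, Complex.mul_im, Complex.ofReal_re,
    Complex.ofReal_im]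
  ring

theorem hasDerivAt_norm_sq (h : IsRadialSolution α lam ψ u) {r : ℝ} (hr : 0 < r) :
    HasDerivAt (fun r => ‖ψ r‖ ^ 2)
      (2 * ((ψ r).re * (u r).re + (ψ r).im * (u r).im) / r) r := by
  simp only [norm_sq_eq_re_im]
  refine (((h.hasDerivAt_re hr).mul (h.hasDerivAt_re hr)).add
    ((h.hasDerivAt_im hr).mul (h.hasDerivAt_im hr))).congr_deriv ?_
  ring

theorem hasDerivAt_norm_flux_sq (h : IsRadialSolution α lam ψ u) {r : ℝ} (hr : 0 < r) :
    HasDerivAt (fun r => ‖u r‖ ^ 2)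
      (2 * (α ^ 2 / r - lam.re * r) * ((ψ r).re * (u r).re + (ψ r).im * (u r).im)
        + 2 * (lam.im * r) * ((ψ r).im * (u r).re - (ψ r).re * (u r).im)) r := by
  simp only [norm_sq_eq_re_im]
  refine (((h.hasDerivAt_flux_re hr).mul (h.hasDerivAt_flux_re hr)).add
    ((h.hasDerivAt_flux_im hr).mul (h.hasDerivAt_flux_im hr))).congr_deriv ?_
  ring

/-! ### Square integrability at infinity -/

/-- A solution in `L²(r dr)` has its derivative `u / r` in `L²(r dr)` near infinity. The reason is
that `(2 Re (conj ψ · u))' = 2 |u|²/r + (an integrable function)`: were `|u|²/r` not integrable,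
`Re (conj ψ · u) = r (|ψ|²)' / 2` would be positive near infinity and `|ψ|²` would increase. -/
theorem integrableOn_norm_flux_sq_div (h : IsRadialSolution α lam ψ u)
    (hψ : IntegrableOn (fun r => r * ‖ψ r‖ ^ 2) (Ioi 0)) :
    IntegrableOn (fun r => ‖u r‖ ^ 2 / r) (Ioi 1) := by
  set P : ℝ → ℝ := fun r => 2 * ((ψ r).re * (u r).re + (ψ r).im * (u r).im)
  set q : ℝ → ℝ := fun r => 2 * (‖u r‖ ^ 2 / r) with hq
  set k : ℝ → ℝ := fun r => 2 * (α ^ 2 / r - lam.re * r) * ‖ψ r‖ ^ 2 with hk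
  have hP : ∀ r : ℝ, 0 < r → HasDerivAt P (q r + k r) r := by
    intro r hr
    refine ((((h.hasDerivAt_re hr).mul (h.hasDerivAt_flux_re hr)).add
      ((h.hasDerivAt_im hr).mul (h.hasDerivAt_flux_im hr))).const_mul 2).congr_deriv ?_
    simp only [hq, hk, norm_sq_eq_re_im]
    ring
  have hsub : Ici (1 : ℝ) ⊆ Ioi 0 := Ici_subset_Ioi.2 one_pos
  have hid : ContinuousOn (fun r : ℝ => r) (Ioi 0) := continuousOn_id
  have hne : ∀ r ∈ Ioi (0 : ℝ), r ≠ 0 := fun r hr => ne_of_gt hr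
  have hqc : ContinuousOn q (Ioi 0) :=
    continuousOn_const.mul ((h.continuousOn_flux.norm.pow 2).div hid hne)
  have hkc : ContinuousOn k (Ioi 0) :=
    (continuousOn_const.mul ((continuousOn_const.div hid hne).sub
      (continuousOn_const.mul hid))).mul (h.continuousOn.norm.pow 2)
  have hII : ∀ {f : ℝ → ℝ} {a b : ℝ}, ContinuousOn f (Ioi 0) → 1 ≤ a → 1 ≤ b →
      IntervalIntegrable f volume a b := by
    intro f a b hf ha hb
    exact (hf.mono fun r hr => lt_of_lt_of_le one_pos
      ((le_min ha hb).trans hr.1)).intervalIntegrable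
  have hki : IntegrableOn k (Ioi 1) := by
    refine Integrable.mono' (g := fun r => 2 * (α ^ 2 + |lam.re|) * (r * ‖ψ r‖ ^ 2))
      ((hψ.mono_set (Ioi_subset_Ioi zero_le_one)).const_mul _)
      ((hkc.mono (Ioi_subset_Ici_self.trans hsub)).aestronglyMeasurable measurableSet_Ioi) ?_
    filter_upwards [ae_restrict_mem measurableSet_Ioi] with r hr
    have hr1 : (1 : ℝ) < r := hr
    have h1 : |α ^ 2 / r - lam.re * r| ≤ (α ^ 2 + |lam.re|) * r := by
      have h2 : α ^ 2 / r ≤ α ^ 2 * r := by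
        rw [div_le_iff₀ (by linarith)]
        nlinarith [mul_nonneg (sq_nonneg α) (by nlinarith : (0 : ℝ) ≤ r * r - 1)]
      have h3 : 0 ≤ α ^ 2 / r := by positivity
      calc |α ^ 2 / r - lam.re * r| ≤ |α ^ 2 / r| + |lam.re * r| := abs_sub _ _
        _ = α ^ 2 / r + |lam.re| * r := by
          rw [abs_of_nonneg h3, abs_mul, abs_of_nonneg (by linarith : (0 : ℝ) ≤ r)]
        _ ≤ _ := by linarith
    rw [hk, Real.norm_eq_abs, abs_mul, abs_mul, abs_two, abs_of_nonneg (sq_nonneg ‖ψ r‖)]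
    nlinarith [mul_le_mul_of_nonneg_right h1 (sq_nonneg ‖ψ r‖)]
  set C := ∫ r in Ioi 1, ‖k r‖
  -- Beyond this bound `P = r (|ψ|²)'` would stay positive, as `P R = P 1 + ∫ q + ∫ k`.
  have hbound : ∀ R : ℝ, 1 ≤ R → ∫ r in (1 : ℝ)..R, q r ≤ C + |P 1| := by
    intro R₀ hR₀
    by_contra! hlt
    have hpos : ∀ R : ℝ, R₀ ≤ R → 0 < P R := by
      intro R hR
      have h1R : 1 ≤ R := hR₀.trans hR
      have hftc : ∫ r in (1 : ℝ)..R, (q r + k r) = P R - P 1 :=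
        intervalIntegral.integral_eq_sub_of_hasDerivAt
          (fun r hr => hP r (by
            rw [uIcc_of_le h1R] at hr
            linarith [hr.1])) ((hII hqc le_rfl h1R).add (hII hkc le_rfl h1R))
      rw [intervalIntegral.integral_add (hII hqc le_rfl h1R) (hII hkc le_rfl h1R)] at hftc
      have hkb : |∫ r in (1 : ℝ)..R, k r| ≤ C := by
        rw [intervalIntegral.integral_of_le h1R]
        exact (norm_integral_le_integral_norm _).trans
          (setIntegral_mono_set hki.norm (Eventually.of_forall fun r => norm_nonneg _)
            (Eventually.of_forall Ioc_subset_Ioi_self))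
      have hqm : ∫ r in (1 : ℝ)..R₀, q r ≤ ∫ r in (1 : ℝ)..R, q r := by
        rw [← intervalIntegral.integral_add_adjacent_intervals (hII hqc le_rfl hR₀)
          (hII hqc hR₀ h1R)]
        have : 0 ≤ ∫ r in R₀..R, q r :=
          intervalIntegral.integral_nonneg hR fun r hr => by
            have : 0 < r := by linarith [hr.1]
            positivity
        linarith
      linarith [neg_abs_le (∫ r in (1 : ℝ)..R, k r), neg_abs_le (P 1)]
    have hmono : StrictMonoOn (fun r => ‖ψ r‖ ^ 2) (Ici R₀) := by
      refine strictMonoOn_of_deriv_pos (convex_Ici _)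
        ((h.continuousOn.norm.pow 2).mono fun r hr => by
          have : R₀ ≤ r := hr
          exact lt_of_lt_of_le one_pos (hR₀.trans this)) fun r hr => ?_
      rw [interior_Ici] at hr
      have hr' : R₀ < r := hr
      have hr0 : 0 < r := by linarith
      rw [(h.hasDerivAt_norm_sq hr0).deriv]
      exact div_pos (hpos r hr'.le) hr0
    -- The step from `R₀` to `R₀ + 1` makes the lower bound for `|ψ|²` strictly positive.
    have hc : 0 < ‖ψ (R₀ + 1)‖ ^ 2 :=
      lt_of_le_of_lt (sq_nonneg ‖ψ R₀‖)
        (hmono (mem_Ici.2 le_rfl) (mem_Ici.2 (by linarith)) (by linarith))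
    refine not_integrableOn_of_le_mul hc (R := R₀ + 1) (fun r hr => ?_) hψ
    have h2 : ‖ψ (R₀ + 1)‖ ^ 2 ≤ ‖ψ r‖ ^ 2 :=
      (hmono (mem_Ici.2 (by linarith)) (mem_Ici.2 (by linarith)) hr).le
    have h3 : 1 ≤ r * r := by nlinarith
    nlinarith [sq_nonneg ‖ψ r‖]
  have hqi : IntegrableOn q (Ioi 1) := by
    refine integrableOn_Ioi_of_intervalIntegral_norm_bounded (l := atTop) (b := fun R : ℝ => max R 1)
      (C + |P 1|) 1 (fun R => ?_) (tendsto_atTop_mono (fun R => le_max_left R 1) tendsto_id) ?_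
    · exact (intervalIntegrable_iff_integrableOn_Ioc_of_le (le_max_right _ _)).1
        (hII hqc le_rfl (le_max_right _ _))
    · refine Eventually.of_forall fun R => ?_
      refine le_of_eq_of_le (intervalIntegral.integral_congr fun r hr => ?_)
        (hbound (max R 1) (le_max_right _ _))
      rw [uIcc_of_le (le_max_right _ _)] at hr
      have : 0 < r := by linarith [hr.1]
      exact Real.norm_of_nonneg (by positivity)
  refine (hqi.const_mul (1 / 2)).congr (Eventually.of_forall fun r => ?_)
  simp only [hq]
  ring

/-- For square-integrable solutions `ψ`, `φ` with fluxes `u`, `v`, the sum `|ψ| |v| + |φ| |u|` cannot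
stay away from `0` near infinity, since divided by `r` it is integrable. All boundary terms at
infinity vanish for this reason. -/
theorem not_le_norm_mul_norm_flux (h : IsRadialSolution α lam ψ u)
    (hψ : IntegrableOn (fun r => r * ‖ψ r‖ ^ 2) (Ioi 0)) {lam' : ℂ}
    (h' : IsRadialSolution α lam' φ v) (hφ : IntegrableOn (fun r => r * ‖φ r‖ ^ 2) (Ioi 0))
    {c R : ℝ} (hc : 0 < c) : ¬ ∀ r : ℝ, R < r → c ≤ ‖ψ r‖ * ‖v r‖ + ‖φ r‖ * ‖u r‖ := by
  intro hle
  have h1 := (hψ.mono_set (Ioi_subset_Ioi zero_le_one)).add (h'.integrableOn_norm_flux_sq_div hφ)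
  have h2 := (hφ.mono_set (Ioi_subset_Ioi zero_le_one)).add (h.integrableOn_norm_flux_sq_div hψ)
  refine not_integrableOn_of_le_mul hc (R := max R 1) (fun r hr => ?_) (h1.add h2)
  have hr1 : 1 < r := lt_of_le_of_lt (le_max_right _ _) hr
  have e := hle r (lt_of_le_of_lt (le_max_left _ _) hr)
  simp only [Pi.add_apply]
  have e1 : r * (r * ‖ψ r‖ ^ 2 + ‖v r‖ ^ 2 / r + (r * ‖φ r‖ ^ 2 + ‖u r‖ ^ 2 / r)) =
      r ^ 2 * ‖ψ r‖ ^ 2 + ‖v r‖ ^ 2 + (r ^ 2 * ‖φ r‖ ^ 2 + ‖u r‖ ^ 2) := by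
    field_simp
  rw [e1]
  have h3 : ∀ a b : ℝ, 0 ≤ a → 0 ≤ b → a * b ≤ r ^ 2 * a ^ 2 + b ^ 2 := by
    intro a b ha hb
    have : 1 ≤ r ^ 2 := by nlinarith
    nlinarith [sq_nonneg (a - b), sq_nonneg a, sq_nonneg b, mul_nonneg ha hb]
  linarith [h3 _ _ (norm_nonneg (ψ r)) (norm_nonneg (v r)),
    h3 _ _ (norm_nonneg (φ r)) (norm_nonneg (u r))]

/-- The Wronskian of two solutions for the same spectral parameter is constant. -/
theorem wronskian_eq (h : IsRadialSolution α lam ψ u) (h' : IsRadialSolution α lam φ v)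
    {r s : ℝ} (hr : 0 < r) (hs : 0 < s) :
    ψ r * v r - φ r * u r = ψ s * v s - φ s * u s := by
  have hd : ∀ r ∈ Ioi (0 : ℝ), HasDerivAt (fun r => ψ r * v r - φ r * u r) 0 r := by
    intro r hr
    refine (((h.hasDerivAt r hr).mul (h'.hasDerivAt_flux r hr)).sub
      ((h'.hasDerivAt r hr).mul (h.hasDerivAt_flux r hr))).congr_deriv ?_
    ring
  exact isOpen_Ioi.is_const_of_deriv_eq_zero isPreconnected_Ioi
    (fun r hr => (hd r hr).differentiableAt.differentiableWithinAt)
    (fun r hr => (hd r hr).deriv) hr hs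

theorem wronskian_eq_zero (h : IsRadialSolution α lam ψ u)
    (hψ : IntegrableOn (fun r => r * ‖ψ r‖ ^ 2) (Ioi 0))
    (h' : IsRadialSolution α lam φ v) (hφ : IntegrableOn (fun r => r * ‖φ r‖ ^ 2) (Ioi 0))
    {r : ℝ} (hr : 0 < r) : ψ r * v r - φ r * u r = 0 := by
  by_contra hne
  refine h.not_le_norm_mul_norm_flux hψ h' hφ (norm_pos_iff.2 hne) (R := 0) fun s hs => ?_
  rw [h.wronskian_eq h' hr hs]
  exact (norm_sub_le _ _).trans (by rw [norm_mul, norm_mul])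

/-- If the Wronskian of `ψ` and a solution `φ` without zeros vanishes, then `ψ` is a multiple
of `φ`. -/
theorem exists_eq_const_mul (h : IsRadialSolution α lam ψ u) (h' : IsRadialSolution α lam φ v)
    (hw : ∀ r : ℝ, 0 < r → ψ r * v r - φ r * u r = 0) (hφ0 : ∀ r : ℝ, 0 < r → φ r ≠ 0) :
    ∃ c : ℂ, ∀ r : ℝ, 0 < r → ψ r = c * φ r := by
  have hd : ∀ r ∈ Ioi (0 : ℝ), HasDerivAt (fun r => ψ r / φ r) 0 r := by
    intro r hr
    have hr' : 0 < r := hr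
    refine ((h.hasDerivAt r hr).div (h'.hasDerivAt r hr) (hφ0 r hr)).congr_deriv ?_
    rw [div_eq_zero_iff]
    left
    linear_combination (-1 / (r : ℂ)) * hw r hr
  refine ⟨ψ 1 / φ 1, fun r hr => ?_⟩
  have : ψ r / φ r = ψ 1 / φ 1 := isOpen_Ioi.is_const_of_deriv_eq_zero isPreconnected_Ioi
    (fun r hr => (hd r hr).differentiableAt.differentiableWithinAt)
    (fun r hr => (hd r hr).deriv) hr (mem_Ioi.2 one_pos)
  rw [← this, div_mul_cancel₀ _ (hφ0 r hr)]

end IsRadialSolution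

/-! ### Complex-valued functions near the origin -/

theorem hasDerivAt_ofReal_rpow (β : ℝ) {r : ℝ} (hr : 0 < r) :
    HasDerivAt (fun r : ℝ => ((r ^ β : ℝ) : ℂ)) ((β * r ^ β / r : ℝ) : ℂ) r := by
  refine (Real.hasDerivAt_rpow_const (p := β) (Or.inl hr.ne')).ofReal_comp.congr_deriv ?_
  rw [Real.rpow_sub_one hr.ne', mul_div_assoc]

/-- A function on `(0, ∞)` whose derivative is `O(r^β)` at `0`, `β > -1`, has a limit at `0`. -/
theorem exists_tendsto_nhdsGT_of_norm_deriv_le {f f' : ℝ → ℂ} {β C : ℝ}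
    (hβ : -1 < β) (hd : ∀ r : ℝ, 0 < r → HasDerivAt f (f' r) r) (hc : ContinuousOn f' (Ioi 0))
    (hb : ∀ᶠ r in 𝓝[>] 0, ‖f' r‖ ≤ C * r ^ β) : ∃ L, Tendsto f (𝓝[>] 0) (𝓝 L) := by
  obtain ⟨T, hT, hbT⟩ := mem_nhdsGT_iff_exists_Ioc_subset.1 hb
  have hT0 : (0 : ℝ) < T := hT
  have hint : IntervalIntegrable f' volume 0 T := by
    rw [intervalIntegrable_iff_integrableOn_Ioc_of_le hT0.le]
    refine Integrable.mono' (g := fun r => C * r ^ β)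
      (((intervalIntegrable_iff_integrableOn_Ioc_of_le hT0.le).1
        (intervalIntegral.intervalIntegrable_rpow' hβ)).const_mul C)
      ((hc.mono Ioc_subset_Ioi_self).aestronglyMeasurable measurableSet_Ioc) ?_
    filter_upwards [ae_restrict_mem measurableSet_Ioc] with r hr using hbT hr
  have hcont := intervalIntegral.continuousOn_primitive_interval' hint right_mem_uIcc
  rw [uIcc_of_le hT0.le] at hcont
  have hlim : Tendsto (fun r => ∫ t in T..r, f' t) (𝓝[>] 0) (𝓝 (∫ t in T..0, f' t)) :=
    (hcont 0 (left_mem_Icc.2 hT0.le)).mono_left (nhdsWithin_le_of_mem (Icc_mem_nhdsGT hT0))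
  refine ⟨_, (hlim.const_add (f T)).congr' ?_⟩
  filter_upwards [Ioo_mem_nhdsGT hT0] with r hr
  have hsub : uIcc T r ⊆ Ioi 0 := by
    rw [uIcc_of_ge hr.2.le]
    exact fun t ht => hr.1.trans_le ht.1
  rw [intervalIntegral.integral_eq_sub_of_hasDerivAt (fun t ht => hd t (hsub ht))
    (hc.mono hsub).intervalIntegrable]
  ring

namespace IsRadialSolution

variable {α : ℝ} {lam : ℂ} {ψ u φ v : ℝ → ℂ}

/-! ### Nonnegative energies -/

/-- For a positive spectral parameter there is no square-integrable solution. The quantity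
`e = |u|² + (l r² - α²) |ψ|²` has derivative `2 l r |ψ|²`, so it is nondecreasing; since `e / r`
is bounded by an integrable function, `e ≤ 0`. Hence `ψ` and `u` vanish where `l r² > α²`, and
Gronwall's inequality carries this to all `r > 0`. -/
theorem eq_zero_of_pos {l : ℝ} (hl : 0 < l) (h : IsRadialSolution α (l : ℂ) ψ u)
    (hψ : IntegrableOn (fun r => r * ‖ψ r‖ ^ 2) (Ioi 0)) {r : ℝ} (hr : 0 < r) : ψ r = 0 := by
  set e : ℝ → ℝ := fun r => ‖u r‖ ^ 2 + (l * r ^ 2 - α ^ 2) * ‖ψ r‖ ^ 2 with he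
  have hd : ∀ r : ℝ, 0 < r → HasDerivAt e (2 * l * r * ‖ψ r‖ ^ 2) r := by
    intro r hr
    refine ((h.hasDerivAt_norm_flux_sq hr).add
      (((((hasDerivAt_id r).pow 2).const_mul l).sub_const (α ^ 2)).mul
        (h.hasDerivAt_norm_sq hr))).congr_deriv ?_
    simp only [Complex.ofReal_re, Complex.ofReal_im, id, Pi.pow_apply]
    field_simp
    ring
  have hmono : MonotoneOn e (Ioi 0) := by
    refine monotoneOn_of_deriv_nonneg (convex_Ioi _)
      (fun r hr => (hd r hr).continuousAt.continuousWithinAt) ?_ ?_ <;> rw [interior_Ioi]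
    · exact fun r hr => (hd r hr).differentiableAt.differentiableWithinAt
    · intro r hr
      have hr' : 0 < r := hr
      rw [(hd r hr).deriv]
      positivity
  have hle : ∀ r : ℝ, 0 < r → e r ≤ 0 := by
    intro r₀ hr₀
    by_contra! hpos
    refine not_integrableOn_of_le_mul hpos (R := r₀) (fun r hr => ?_)
      ((h.integrableOn_norm_flux_sq_div hψ).add
        ((hψ.mono_set (Ioi_subset_Ioi zero_le_one)).const_mul l))
    have hr0 : 0 < r := hr₀.trans hr
    refine (hmono hr₀ hr0 hr.le).trans ?_
    simp only [he, Pi.add_apply]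
    have e1 : r * (‖u r‖ ^ 2 / r + l * (r * ‖ψ r‖ ^ 2)) =
        ‖u r‖ ^ 2 + l * r ^ 2 * ‖ψ r‖ ^ 2 := by field_simp
    rw [e1]
    nlinarith [mul_nonneg (sq_nonneg α) (sq_nonneg ‖ψ r‖)]
  -- A point `T ≥ r` with `l T² > α²`, where `e T ≤ 0` forces `ψ T = 0` and `u T = 0`.
  set T : ℝ := r + (α ^ 2 + 1) / l + 1 with hT
  have hq : 0 < (α ^ 2 + 1) / l := by positivity
  have hT0 : 0 < T := by positivity
  have hrT : r ≤ T := by linarith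
  set N : ℝ → ℝ := fun r => ‖ψ r‖ ^ 2 + ‖u r‖ ^ 2 with hN
  have hNT : N T = 0 := by
    have h1 : 0 < l * T ^ 2 - α ^ 2 := by
      have h2 : α ^ 2 + 1 ≤ l * T := by
        calc α ^ 2 + 1 = l * ((α ^ 2 + 1) / l) := by field_simp
          _ ≤ l * T := by gcongr; linarith
      have h3 : 1 ≤ T := by linarith
      nlinarith [sq_nonneg α]
    have h2 := hle T hT0
    have h3 : 0 ≤ (l * T ^ 2 - α ^ 2) * ‖ψ T‖ ^ 2 := by positivity
    have h4 : ‖u T‖ ^ 2 = 0 := le_antisymm (by simp only [he] at h2; linarith) (sq_nonneg _)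
    have h5 : (l * T ^ 2 - α ^ 2) * ‖ψ T‖ ^ 2 = 0 :=
      le_antisymm (by simp only [he] at h2; linarith [sq_nonneg ‖u T‖]) h3
    have h6 := (mul_eq_zero.1 h5).resolve_left h1.ne'
    simp only [hN, h4, h6, add_zero]
  -- On `[r, T]` one has `|N'| ≤ C N`, so `N exp(C s)` is nondecreasing there.
  set C : ℝ := (1 + α ^ 2) / r + l * T with hC
  have hM : ∀ s : ℝ, 0 < s → HasDerivAt (fun s => N s * Real.exp (C * s))
      ((2 * (1 / s + (α ^ 2 / s - l * s)) * ((ψ s).re * (u s).re + (ψ s).im * (u s).im)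
        + C * N s) * Real.exp (C * s)) s := by
    intro s hs
    refine (((h.hasDerivAt_norm_sq hs).add (h.hasDerivAt_norm_flux_sq hs)).mul
      (((hasDerivAt_id s).const_mul C).exp)).congr_deriv ?_
    simp only [Complex.ofReal_re, Complex.ofReal_im, id, hN, Pi.add_apply]
    ring
  have hMmono : MonotoneOn (fun s => N s * Real.exp (C * s)) (Icc r T) := by
    refine monotoneOn_of_deriv_nonneg (convex_Icc _ _)
      (fun s hs => (hM s (hr.trans_le hs.1)).continuousAt.continuousWithinAt) ?_ ?_ <;>
      rw [interior_Icc]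
    · exact fun s hs => (hM s (hr.trans hs.1)).differentiableAt.differentiableWithinAt
    · intro s hs
      have hs0 : 0 < s := hr.trans hs.1
      rw [(hM s hs0).deriv]
      refine mul_nonneg ?_ (Real.exp_pos _).le
      set X := (ψ s).re * (u s).re + (ψ s).im * (u s).im
      have hX : |2 * X| ≤ N s := by
        simp only [hN, norm_sq_eq_re_im]
        rw [abs_le]
        constructor
        · nlinarith [sq_nonneg ((ψ s).re + (u s).re), sq_nonneg ((ψ s).im + (u s).im)]
        · nlinarith [sq_nonneg ((ψ s).re - (u s).re), sq_nonneg ((ψ s).im - (u s).im)]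
      have hco : |1 / s + (α ^ 2 / s - l * s)| ≤ C := by
        have h1 : (1 + α ^ 2) / s ≤ (1 + α ^ 2) / r := by
          gcongr
          exact hs.1.le
        have h2 : l * s ≤ l * T := by
          gcongr
          exact hs.2.le
        have h3 : 0 ≤ (1 + α ^ 2) / s := by positivity
        have h4 : 0 ≤ l * s := by positivity
        rw [show 1 / s + (α ^ 2 / s - l * s) = (1 + α ^ 2) / s - l * s by ring, abs_le]
        constructor <;> simp only [hC] <;> linarith
      have h5 := mul_le_mul hco hX (abs_nonneg _) ((abs_nonneg _).trans hco)
      rw [← abs_mul] at h5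
      have h6 := neg_abs_le ((1 / s + (α ^ 2 / s - l * s)) * (2 * X))
      linarith
  have h1 := hMmono (left_mem_Icc.2 hrT) (right_mem_Icc.2 hrT) hrT
  simp only [hNT, zero_mul] at h1
  have h2 : N r ≤ 0 := by
    by_contra! hpos
    exact absurd h1 (not_le.2 (mul_pos hpos (Real.exp_pos _)))
  have h3 : ‖ψ r‖ ^ 2 = 0 :=
    le_antisymm (by simp only [hN] at h2; linarith [sq_nonneg ‖u r‖]) (sq_nonneg _)
  exact norm_eq_zero.1 (pow_eq_zero_iff two_ne_zero |>.1 h3)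

theorem rpow_neg (α : ℝ) : IsRadialSolution α 0 (fun r => ((r ^ (-α) : ℝ) : ℂ))
    (fun r => -(α : ℂ) * ((r ^ (-α) : ℝ) : ℂ)) where
  hasDerivAt r hr := (hasDerivAt_ofReal_rpow (-α) hr).congr_deriv (by push_cast; ring)
  hasDerivAt_flux r hr :=
    ((hasDerivAt_ofReal_rpow (-α) hr).const_mul (-(α : ℂ))).congr_deriv (by push_cast; ring)

/-- For the spectral parameter `0` the solutions are spanned by `r^α` and `r^(-α)`, and no nonzero
combination is square-integrable at infinity. The Wronskian of `ψ` with `r^(-α)` is constant; it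
is `0` because `|ψ| + |u|` cannot stay away from `0`. Thus `ψ = c r^(-α)`, and `c = 0` because
`r^(1-2α)` is not integrable at infinity. -/
theorem eq_zero_of_zero (hα0 : 0 < α) (hα1 : α < 1) (h : IsRadialSolution α 0 ψ u)
    (hψ : IntegrableOn (fun r => r * ‖ψ r‖ ^ 2) (Ioi 0)) {r : ℝ} (hr : 0 < r) : ψ r = 0 := by
  have hw : ∀ r : ℝ, 0 < r →
      ψ r * (-(α : ℂ) * ((r ^ (-α) : ℝ) : ℂ)) - ((r ^ (-α) : ℝ) : ℂ) * u r = 0 := by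
    intro r₀ hr₀
    by_contra hne
    have hpos := norm_pos_iff.2 hne
    set c := ‖ψ r₀ * (-(α : ℂ) * ((r₀ ^ (-α) : ℝ) : ℂ)) - ((r₀ ^ (-α) : ℝ) : ℂ) * u r₀‖ with hc
    refine not_integrableOn_of_le_mul (c := c ^ 2 / 2) (by positivity) (R := 1) (fun r hr => ?_)
      ((h.integrableOn_norm_flux_sq_div hψ).add (hψ.mono_set (Ioi_subset_Ioi zero_le_one)))
    have hr0 : 0 < r := one_pos.trans hr
    have h1 : c ≤ ‖ψ r‖ + ‖u r‖ := by
      rw [hc, h.wronskian_eq (rpow_neg α) hr₀ hr0]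
      have h2 : r ^ (-α) ≤ 1 := Real.rpow_le_one_of_one_le_of_nonpos hr.le (by linarith)
      have h3 : 0 < r ^ (-α) := Real.rpow_pos_of_pos hr0 _
      refine (norm_sub_le _ _).trans ?_
      rw [norm_mul, norm_mul, norm_mul, norm_neg, Complex.norm_real, Complex.norm_real,
        Real.norm_of_nonneg hα0.le, Real.norm_of_nonneg h3.le]
      have h4 : α * r ^ (-α) ≤ 1 := mul_le_one₀ hα1.le h3.le h2
      nlinarith [norm_nonneg (ψ r), norm_nonneg (u r)]
    simp only [Pi.add_apply]
    have e1 : r * (‖u r‖ ^ 2 / r + r * ‖ψ r‖ ^ 2) = ‖u r‖ ^ 2 + r ^ 2 * ‖ψ r‖ ^ 2 := by field_simp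
    rw [e1]
    have h5 : 1 ≤ r ^ 2 := by nlinarith
    have h6 : c ^ 2 ≤ (‖ψ r‖ + ‖u r‖) ^ 2 := by gcongr
    nlinarith [sq_nonneg (‖ψ r‖ - ‖u r‖), sq_nonneg ‖ψ r‖]
  obtain ⟨c, hc⟩ := h.exists_eq_const_mul (rpow_neg α) hw fun r hr => by
    exact_mod_cast (Real.rpow_pos_of_pos hr _).ne'
  by_cases hc0 : c = 0
  · rw [hc r hr, hc0, zero_mul]
  · exfalso
    have hcpos := norm_pos_iff.2 hc0
    refine not_integrableOn_of_le_mul (c := ‖c‖ ^ 2) (by positivity) (R := 1) (fun r hr => ?_) hψ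
    have hr0 : 0 < r := one_pos.trans hr
    rw [hc r hr0, norm_mul, Complex.norm_real, Real.norm_of_nonneg (Real.rpow_nonneg hr0.le _)]
    have h1 : 1 ≤ r * r ^ (-α) := by
      rw [mul_comm, ← Real.rpow_add_one hr0.ne']
      exact Real.one_le_rpow hr.le (by linarith)
    have h2 : 1 ≤ (r * r ^ (-α)) ^ 2 := one_le_pow₀ h1
    calc ‖c‖ ^ 2 ≤ ‖c‖ ^ 2 * (r * r ^ (-α)) ^ 2 := le_mul_of_one_le_right (by positivity) h2
      _ = _ := by ring

/-! ### Boundary values at the origin -/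

/-- Near `0` put `p = r^α ψ` and `S = r^(-α) (u + α ψ)`. Then `S' = -lam r^(1-2α) p` is integrable
at `0` and `p' = r^(2α-1) S`, so `S` has a limit, which l'Hôpital's rule identifies as
`2 α ψ₁` since `ψ₁ = lim (p - ψ₀) / r^(2α)`. -/
theorem tendsto_flux_of_hasBoundaryValues {j : ℝ} (hj0 : j ≠ 0) (hj1 : |j| < 1)
    (h : IsRadialSolution |j| lam ψ u) {c₀ c₁ : ℂ} (hb : HasBoundaryValues j ψ c₀ c₁) :
    Tendsto (fun r : ℝ => ((r ^ (-|j|) : ℝ) : ℂ) * (u r + |j| * ψ r)) (𝓝[>] 0)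
      (𝓝 (2 * |j| * c₁)) := by
  have hα : 0 < |j| := abs_pos.2 hj0
  set α := |j| with hαj
  set p : ℝ → ℂ := fun r => ((r ^ α : ℝ) : ℂ) * ψ r with hp
  set S : ℝ → ℂ := fun r => ((r ^ (-α) : ℝ) : ℂ) * (u r + α * ψ r) with hS
  have hp0 : Tendsto p (𝓝[>] 0) (𝓝 c₀) := hb.1
  have hSd : ∀ r : ℝ, 0 < r → HasDerivAt S (-lam * ((r ^ (1 - 2 * α) : ℝ) : ℂ) * p r) r := by
    intro r hr
    have hrc : (r : ℂ) ≠ 0 := by exact_mod_cast hr.ne'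
    refine ((hasDerivAt_ofReal_rpow (-α) hr).mul ((h.hasDerivAt_flux r hr).add
      ((h.hasDerivAt r hr).const_mul (α : ℂ)))).congr_deriv ?_
    have e : r ^ (1 - 2 * α) = r * (r ^ (-α) * r ^ (-α)) := by
      rw [show 1 - 2 * α = 1 + (-α + -α) by ring, Real.rpow_add hr, Real.rpow_add hr,
        Real.rpow_one]
    have e2 : ((r ^ (-α) : ℝ) : ℂ) * ((r ^ α : ℝ) : ℂ) = 1 := by
      rw [← Complex.ofReal_mul, ← Real.rpow_add hr]
      simp
    simp only [hp, e]
    push_cast [Pi.add_apply]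
    simp only [hαj] at e2 ⊢
    field_simp
    linear_combination (lam * (r : ℂ) ^ 2 * ψ r * ((r ^ (-|j|) : ℝ) : ℂ)) * e2
  have hpd : ∀ r : ℝ, 0 < r → HasDerivAt p (((r ^ (2 * α - 1) : ℝ) : ℂ) * S r) r := by
    intro r hr
    have hrc : (r : ℂ) ≠ 0 := by exact_mod_cast hr.ne'
    refine ((hasDerivAt_ofReal_rpow α hr).mul (h.hasDerivAt r hr)).congr_deriv ?_
    have e : r ^ (2 * α - 1) * r ^ (-α) = r ^ α / r := by
      rw [← Real.rpow_add hr, ← Real.rpow_sub_one hr.ne']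
      ring_nf
    simp only [hS]
    rw [← mul_assoc, ← Complex.ofReal_mul, e]
    push_cast
    field_simp
    ring
  have hlim : ∃ S₀, Tendsto S (𝓝[>] 0) (𝓝 S₀) := by
    refine exists_tendsto_nhdsGT_of_norm_deriv_le (β := 1 - 2 * α) (C := ‖lam‖ * (‖c₀‖ + 1))
      (by linarith) hSd ?_ ?_
    · refine (continuousOn_const.mul ?_).mul fun r hr =>
        (hpd r hr).continuousAt.continuousWithinAt
      exact fun r hr => (hasDerivAt_ofReal_rpow _ hr).continuousAt.continuousWithinAt
    · filter_upwards [hp0.norm.eventually_le_const (lt_add_one ‖c₀‖), self_mem_nhdsWithin]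
        with r h1 hr
      have h2 : 0 ≤ r ^ (1 - 2 * α) := Real.rpow_nonneg (le_of_lt hr) _
      rw [norm_mul, norm_mul, norm_neg, Complex.norm_real, Real.norm_of_nonneg h2]
      calc ‖lam‖ * r ^ (1 - 2 * α) * ‖p r‖ ≤ ‖lam‖ * r ^ (1 - 2 * α) * (‖c₀‖ + 1) := by gcongr
        _ = _ := by ring
  obtain ⟨S₀, hS₀⟩ := hlim
  -- L'Hôpital's rule is available for real functions only: apply it to real-linear functionals.
  have key : ∀ ℓ : ℂ →L[ℝ] ℝ, ℓ S₀ / (2 * α) = ℓ c₁ := by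
    intro ℓ
    have h1 : Tendsto (fun r : ℝ => ℓ (p r - c₀) / r ^ (2 * α)) (𝓝[>] 0) (𝓝 (ℓ S₀ / (2 * α))) := by
      refine HasDerivAt.lhopital_zero_nhdsGT
        (f' := fun r => ℓ (((r ^ (2 * α - 1) : ℝ) : ℂ) * S r))
        (g' := fun r => 2 * α * r ^ (2 * α - 1)) ?_ ?_ ?_ ?_ ?_ ?_
      · filter_upwards [self_mem_nhdsWithin] with r hr
        exact ℓ.hasFDerivAt.comp_hasDerivAt r ((hpd r hr).sub_const c₀)
      · filter_upwards [self_mem_nhdsWithin] with r hr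
        exact Real.hasDerivAt_rpow_const (Or.inl (ne_of_gt hr))
      · filter_upwards [self_mem_nhdsWithin] with r hr
        have := Real.rpow_pos_of_pos hr (2 * α - 1)
        positivity
      · have := (ℓ.continuous.tendsto _).comp (hp0.sub_const c₀)
        rw [sub_self, map_zero] at this
        exact this
      · have : ContinuousAt (fun r : ℝ => r ^ (2 * α)) 0 :=
          Real.continuousAt_rpow_const _ _ (Or.inr (by positivity))
        have := this.tendsto.mono_left (nhdsWithin_le_nhds (s := Ioi 0))
        simpa [Real.zero_rpow (by positivity : 2 * α ≠ 0)] using this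
      · have := ((ℓ.continuous.tendsto _).comp hS₀).div_const (2 * α)
        refine this.congr' ?_
        filter_upwards [self_mem_nhdsWithin] with r hr
        have hne := (Real.rpow_pos_of_pos hr (2 * α - 1)).ne'
        rw [← Complex.real_smul, ℓ.map_smul, smul_eq_mul, mul_comm (2 * α),
          mul_div_mul_left _ _ hne]
        rfl
    refine tendsto_nhds_unique h1 ?_
    refine ((ℓ.continuous.tendsto _).comp hb.2).congr' ?_
    filter_upwards [self_mem_nhdsWithin] with r hr
    have hr' : 0 < r := hr
    have hne := (Real.rpow_pos_of_pos hr' α).ne'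
    have hne' : ((r ^ α : ℝ) : ℂ) ≠ 0 := by exact_mod_cast hne
    have e : ((1 / r ^ α : ℝ) : ℂ) * (ψ r - c₀ * ((1 / r ^ α : ℝ) : ℂ)) =
        (((r ^ (2 * α))⁻¹ : ℝ) : ℂ) * (p r - c₀) := by
      rw [two_mul, Real.rpow_add hr']
      push_cast
      simp only [hp]
      field_simp
    simp only [Function.comp]
    rw [← hαj, e, ← Complex.real_smul, ℓ.map_smul, smul_eq_mul, div_eq_inv_mul]
  have : S₀ = 2 * α * c₁ := by
    have h1 := key Complex.reCLM
    have h2 := key Complex.imCLM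
    have h3 : 2 * α ≠ 0 := by positivity
    rw [div_eq_iff h3] at h1 h2
    rw [show (2 * α * c₁ : ℂ) = ((2 * α : ℝ) : ℂ) * c₁ by push_cast; ring]
    refine Complex.ext ?_ ?_
    · rw [Complex.re_ofReal_mul]
      simpa [mul_comm] using h1
    · rw [Complex.im_ofReal_mul]
      simpa [mul_comm] using h2
  rw [← this]
  exact hS₀

/-! ### Nonreal energies -/

/-- Symmetry of the extension: `V = -Im lam · Im (conj ψ · u)` has derivative
`(Im lam)² r |ψ|² ≥ 0`. A boundary condition with `Im (conj ψ₀ · ψ₁) = 0` gives `V → 0` at the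
origin, and square integrability keeps `V` from staying away from `0` at infinity. -/
theorem eq_zero_of_im_ne_zero {j : ℝ} (hj0 : j ≠ 0) (hj1 : |j| < 1)
    (h : IsRadialSolution |j| lam ψ u) {c₀ c₁ : ℂ} (hb : HasBoundaryValues j ψ c₀ c₁)
    (hc : c₀.re * c₁.im - c₀.im * c₁.re = 0) (hlam : lam.im ≠ 0)
    (hψ : IntegrableOn (fun r => r * ‖ψ r‖ ^ 2) (Ioi 0)) {r : ℝ} (hr : 0 < r) : ψ r = 0 := by
  set b := lam.im with hbdef
  set V : ℝ → ℝ := fun r => -b * ((ψ r).re * (u r).im - (ψ r).im * (u r).re) with hV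
  have hd : ∀ r ∈ Ioi (0 : ℝ), HasDerivAt V (b ^ 2 * r * ‖ψ r‖ ^ 2) r := by
    intro r hr
    refine ((((h.hasDerivAt_re hr).mul (h.hasDerivAt_flux_im hr)).sub
      ((h.hasDerivAt_im hr).mul (h.hasDerivAt_flux_re hr))).const_mul (-b)).congr_deriv ?_
    rw [norm_sq_eq_re_im, ← hbdef]
    ring
  have hmono : MonotoneOn V (Ioi 0) := by
    refine monotoneOn_of_deriv_nonneg (convex_Ioi _)
      (fun r hr => (hd r hr).continuousAt.continuousWithinAt) ?_ ?_ <;> rw [interior_Ioi]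
    · exact fun r hr => (hd r hr).differentiableAt.differentiableWithinAt
    · intro r hr
      have hr' : 0 < r := hr
      rw [(hd r hr).deriv]
      positivity
  have hV0 : Tendsto V (𝓝[>] 0) (𝓝 0) := by
    have hS := h.tendsto_flux_of_hasBoundaryValues hj0 hj1 hb
    have hp := hb.1
    -- With `p` and `S` as for the flux limit, `Im (conj ψ · u) = Im (conj p · S)`.
    have re' : ∀ {f : ℝ → ℂ} {z : ℂ}, Tendsto f (𝓝[>] 0) (𝓝 z) →
        Tendsto (fun r => (f r).re) (𝓝[>] 0) (𝓝 z.re) := fun hf =>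
      (Complex.continuous_re.tendsto _).comp hf
    have im' : ∀ {f : ℝ → ℂ} {z : ℂ}, Tendsto f (𝓝[>] 0) (𝓝 z) →
        Tendsto (fun r => (f r).im) (𝓝[>] 0) (𝓝 z.im) := fun hf =>
      (Complex.continuous_im.tendsto _).comp hf
    have hlim := (((re' hp).mul (im' hS)).sub ((im' hp).mul (re' hS))).const_mul (-b)
    have e : -b * (c₀.re * (2 * ((|j| : ℝ) : ℂ) * c₁).im - c₀.im * (2 * ((|j| : ℝ) : ℂ) * c₁).re) = 0 := by
      rw [show (2 * ((|j| : ℝ) : ℂ) * c₁ : ℂ) = ((2 * |j| : ℝ) : ℂ) * c₁ by push_cast; ring,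
        Complex.re_ofReal_mul, Complex.im_ofReal_mul]
      linear_combination (-b * (2 * |j|)) * hc
    rw [e] at hlim
    refine hlim.congr' ?_
    filter_upwards [self_mem_nhdsWithin] with r hr
    have hr' : 0 < r := hr
    have e2 : r ^ |j| * r ^ (-|j|) = 1 := by rw [← Real.rpow_add hr']; simp
    simp only [hV, Complex.re_ofReal_mul, Complex.im_ofReal_mul, Complex.add_re, Complex.add_im]
    linear_combination (-b * ((ψ r).re * (u r).im - (ψ r).im * (u r).re)) * e2
  have hnonneg : ∀ r : ℝ, 0 < r → 0 ≤ V r := by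
    intro r hr
    refine le_of_tendsto hV0 ?_
    filter_upwards [Ioo_mem_nhdsGT hr] with s hs
    exact hmono hs.1 hr hs.2.le
  have hzero : ∀ r : ℝ, 0 < r → V r = 0 := by
    intro r₀ hr₀
    by_contra hne
    have hpos : 0 < V r₀ := lt_of_le_of_ne (hnonneg r₀ hr₀) (Ne.symm hne)
    have hb0 : 0 < |b| := abs_pos.2 hlam
    refine h.not_le_norm_mul_norm_flux hψ h hψ (c := V r₀ / |b|) (by positivity)
      (R := r₀) fun r hr => ?_
    have h1 : V r₀ ≤ V r := hmono hr₀ (hr₀.trans hr) hr.le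
    have h2 : (ψ r).re * (u r).im - (ψ r).im * (u r).re = (starRingEnd ℂ (ψ r) * u r).im := by
      simp [Complex.mul_im]
      ring
    have h3 : V r ≤ |b| * (‖ψ r‖ * ‖u r‖) := by
      simp only [hV, h2]
      refine (le_abs_self _).trans ?_
      rw [abs_mul, abs_neg]
      gcongr
      exact (Complex.abs_im_le_norm _).trans (by rw [norm_mul, RCLike.norm_conj])
    rw [div_le_iff₀ hb0]
    nlinarith [mul_nonneg hb0.le (mul_nonneg (norm_nonneg (ψ r)) (norm_nonneg (u r)))]
  have h1 : deriv V r = 0 := by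
    have : V =ᶠ[𝓝 r] fun _ => 0 := by
      filter_upwards [Ioi_mem_nhds hr] with s hs using hzero s hs
    rw [this.deriv_eq, deriv_const]
  rw [(hd r hr).deriv] at h1
  have h2 : ‖ψ r‖ ^ 2 = 0 := by
    rcases mul_eq_zero.1 h1 with h3 | h3
    · exact absurd h3 (by positivity)
    · exact h3
  exact norm_eq_zero.1 (pow_eq_zero_iff two_ne_zero |>.1 h2)

end IsRadialSolution

/-! ### The decaying solution for negative energies -/

/-- The solution `r^(-α) ∫₀^∞ t^(α-1) exp(-t - m r²/(4t)) dt` for the spectral parameter `-m < 0`,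
a multiple of `K_α(√m r)`. -/
noncomputable def decayingSolution (α m r : ℝ) : ℂ :=
  ((r ^ (-α) * besselIntegral α (m * r ^ 2 / 4) : ℝ) : ℂ)

/-- The flux `r ψ'(r)` of `ψ = decayingSolution α m`. -/
noncomputable def decayingFlux (α m r : ℝ) : ℂ :=
  ((-α * (r ^ (-α) * besselIntegral α (m * r ^ 2 / 4))
    - m / 2 * r ^ 2 * (r ^ (-α) * besselIntegral (α - 1) (m * r ^ 2 / 4)) : ℝ) : ℂ)

theorem hasDerivAt_rpow_mul_besselIntegral (α s : ℝ) {m r : ℝ} (hm : 0 < m) (hr : 0 < r) :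
    HasDerivAt (fun r => r ^ (-α) * besselIntegral s (m * r ^ 2 / 4))
      ((-α * (r ^ (-α) * besselIntegral s (m * r ^ 2 / 4))
        - m / 2 * r ^ 2 * (r ^ (-α) * besselIntegral (s - 1) (m * r ^ 2 / 4))) / r) r := by
  have h1 : HasDerivAt (fun r : ℝ => m * r ^ 2 / 4) (m * (2 * r) / 4) r := by
    simpa using (((hasDerivAt_id r).pow 2).const_mul m).div_const 4
  have h2 := (hasDerivAt_besselIntegral s (y := m * r ^ 2 / 4) (by positivity)).comp r h1
  refine ((Real.hasDerivAt_rpow_const (p := -α) (Or.inl hr.ne')).mul h2).congr_deriv ?_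
  rw [Real.rpow_sub_one hr.ne']
  simp only [Function.comp]
  field_simp
  ring

theorem isRadialSolution_decayingSolution (α : ℝ) {m : ℝ} (hm : 0 < m) :
    IsRadialSolution α (-(m : ℂ)) (decayingSolution α m) (decayingFlux α m) where
  hasDerivAt r hr := by
    refine (hasDerivAt_rpow_mul_besselIntegral α α hm hr).ofReal_comp.congr_deriv ?_
    rw [decayingFlux]
    push_cast
    rfl
  hasDerivAt_flux r hr := by
    have h2 : HasDerivAt (fun r : ℝ => m / 2 * r ^ 2) (m * r) r := by
      refine (((hasDerivAt_id r).pow 2).const_mul (m / 2)).congr_deriv ?_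
      simp only [id]
      ring
    have hd := ((hasDerivAt_rpow_mul_besselIntegral α α hm hr).const_mul (-α)).sub
      (h2.mul (hasDerivAt_rpow_mul_besselIntegral α (α - 1) hm hr))
    refine hd.ofReal_comp.congr_deriv ?_
    have hrec := besselIntegral_recurrence (α - 1) (y := m * r ^ 2 / 4) (by positivity)
    rw [sub_add_cancel] at hrec
    rw [decayingSolution, show (α : ℂ) ^ 2 / (r : ℂ) - -(m : ℂ) * (r : ℂ) =
      ((α ^ 2 / r + m * r : ℝ) : ℂ) by push_cast; ring, ← Complex.ofReal_mul]
    congr 1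
    field_simp
    linear_combination (m * r ^ 2 * 4) * hrec

theorem decayingSolution_ne_zero (α : ℝ) {m r : ℝ} (hm : 0 < m) (hr : 0 < r) :
    decayingSolution α m r ≠ 0 := by
  have h1 := besselIntegral_pos α (y := m * r ^ 2 / 4) (by positivity)
  have h2 := Real.rpow_pos_of_pos hr (-α)
  exact Complex.ofReal_ne_zero.2 (mul_pos h2 h1).ne'

theorem integrableOn_decayingSolution {α m : ℝ} (hα0 : 0 < α) (hα1 : α < 1) (hm : 0 < m) :
    IntegrableOn (fun r => r * ‖decayingSolution α m r‖ ^ 2) (Ioi 0) := by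
  have hmeas : ContinuousOn (fun r => r * ‖decayingSolution α m r‖ ^ 2) (Ioi 0) :=
    continuousOn_id.mul ((isRadialSolution_decayingSolution α hm).continuousOn.norm.pow 2)
  -- `n = 0` is used near the origin, `n = 1` near infinity.
  have hbound : ∀ n : ℕ, ∃ C : ℝ, ∀ r : ℝ, 0 < r → ‖r * ‖decayingSolution α m r‖ ^ 2‖ ≤
      C * r ^ (1 - 2 * α - 4 * n) := by
    refine fun n => ⟨(n.factorial / (m / 4) ^ n * Real.Gamma (α + n)) ^ 2, fun r hr => ?_⟩
    have h1 := besselIntegral_pos α (y := m * r ^ 2 / 4) (by positivity)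
    have h2 := Real.rpow_pos_of_pos hr (-α)
    have h3 := besselIntegral_le (s := α) (y := m * r ^ 2 / 4) (by positivity) n (by positivity)
    have e : r ^ (1 - 2 * α - 4 * n) = r * (r ^ (-α) / (r ^ 2) ^ n) ^ 2 := by
      rw [show 1 - 2 * α - 4 * n = 1 + ((-α) + (-α) - ((4 * n : ℕ) : ℝ)) by push_cast; ring,
        Real.rpow_add hr, Real.rpow_one, Real.rpow_sub hr, Real.rpow_add hr, Real.rpow_natCast,
        div_pow]
      ring_nf
    rw [decayingSolution, Complex.norm_real, Real.norm_of_nonneg (mul_pos h2 h1).le,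
      Real.norm_of_nonneg (by positivity), e]
    calc r * (r ^ (-α) * besselIntegral α (m * r ^ 2 / 4)) ^ 2
        ≤ r * (r ^ (-α) * (n.factorial / (m * r ^ 2 / 4) ^ n * Real.Gamma (α + n))) ^ 2 := by
          gcongr
      _ = _ := by
          rw [show m * r ^ 2 / 4 = m / 4 * r ^ 2 by ring, mul_pow]
          ring
  rw [← Ioc_union_Ioi_eq_Ioi (zero_le_one (α := ℝ))]
  refine IntegrableOn.union ?_ ?_
  · obtain ⟨C, hC⟩ := hbound 0
    refine Integrable.mono' (((intervalIntegrable_iff_integrableOn_Ioc_of_le zero_le_one).1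
      (intervalIntegral.intervalIntegrable_rpow' (r := 1 - 2 * α - 4 * (0 : ℕ))
        (by push_cast; linarith))).const_mul C)
      ((hmeas.mono Ioc_subset_Ioi_self).aestronglyMeasurable measurableSet_Ioc) ?_
    filter_upwards [ae_restrict_mem measurableSet_Ioc] with r hr using hC r hr.1
  · obtain ⟨C, hC⟩ := hbound 1
    refine Integrable.mono' (((integrableOn_Ioi_rpow_iff (s := 1 - 2 * α - 4 * (1 : ℕ))
      one_pos).2 (by push_cast; linarith)).const_mul C)
      ((hmeas.mono (Ioi_subset_Ioi zero_le_one)).aestronglyMeasurable measurableSet_Ioi) ?_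
    filter_upwards [ae_restrict_mem measurableSet_Ioi] with r hr
      using hC r (one_pos.trans hr)

/-- The second boundary value is computed by l'Hôpital's rule; the derivative that occurs is
`besselIntegral (α - 1)`, whose behaviour at `0` follows from the substitution `t ↦ y/t`. -/
theorem hasBoundaryValues_decayingSolution {j m : ℝ} (hj0 : j ≠ 0) (hj1 : |j| < 1) (hm : 0 < m) :
    HasBoundaryValues j (decayingSolution |j| m) (Real.Gamma |j| : ℝ)
      (-((m / 4) ^ |j| * Real.Gamma (1 - |j|) / |j|) : ℝ) := by
  have hα : 0 < |j| := abs_pos.2 hj0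
  set α := |j| with hαj
  have hy : Tendsto (fun r : ℝ => m * r ^ 2 / 4) (𝓝[>] 0) (𝓝[>] 0) := by
    refine tendsto_nhdsWithin_iff.2 ⟨?_, ?_⟩
    · have : Continuous fun r : ℝ => m * r ^ 2 / 4 := by fun_prop
      have := (this.tendsto 0).mono_left (nhdsWithin_le_nhds (s := Ioi 0))
      simpa using this
    · filter_upwards [self_mem_nhdsWithin] with r hr
      have hr' : 0 < r := hr
      exact mem_Ioi.2 (by positivity)
  have hF := (tendsto_besselIntegral_zero hα).comp hy
  have hinv : ∀ r : ℝ, 0 < r → r ^ α * r ^ (-α) = 1 := fun r hr => by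
    rw [← Real.rpow_add hr]; simp
  constructor
  · refine ((Complex.continuous_ofReal.tendsto _).comp hF).congr' ?_
    filter_upwards [self_mem_nhdsWithin] with r hr
    rw [decayingSolution, ← Complex.ofReal_mul, ← mul_assoc, hinv r hr, one_mul]
    rfl
  · have hlim : Tendsto (fun r : ℝ => (besselIntegral α (m * r ^ 2 / 4) - Real.Gamma α) /
        r ^ (2 * α)) (𝓝[>] 0) (𝓝 (-((m / 4) ^ α * Real.Gamma (1 - α) / α))) := by
      refine HasDerivAt.lhopital_zero_nhdsGT
        (f' := fun r => -besselIntegral (α - 1) (m * r ^ 2 / 4) * (m * (2 * r) / 4))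
        (g' := fun r => 2 * α * r ^ (2 * α - 1)) ?_ ?_ ?_ ?_ ?_ ?_
      · filter_upwards [self_mem_nhdsWithin] with r hr
        have hr' : 0 < r := hr
        have h1 : HasDerivAt (fun r : ℝ => m * r ^ 2 / 4) (m * (2 * r) / 4) r := by
          simpa using (((hasDerivAt_id r).pow 2).const_mul m).div_const 4
        exact ((hasDerivAt_besselIntegral α (y := m * r ^ 2 / 4) (by positivity)).comp r
          h1).sub_const _
      · filter_upwards [self_mem_nhdsWithin] with r hr
        exact Real.hasDerivAt_rpow_const (Or.inl (ne_of_gt hr))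
      · filter_upwards [self_mem_nhdsWithin] with r hr
        have := Real.rpow_pos_of_pos hr (2 * α - 1)
        positivity
      · have := hF.sub_const (Real.Gamma α)
        rw [sub_self] at this
        exact this
      · have : ContinuousAt (fun r : ℝ => r ^ (2 * α)) 0 :=
          Real.continuousAt_rpow_const _ _ (Or.inr (by positivity))
        have := this.tendsto.mono_left (nhdsWithin_le_nhds (s := Ioi 0))
        simpa [Real.zero_rpow (by positivity : 2 * α ≠ 0)] using this
      · have h1 := ((tendsto_besselIntegral_zero (s := 1 - α) (by linarith)).comp
          hy).const_mul (-((m / 4) ^ α / α))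
        rw [show -((m / 4) ^ α / α) * Real.Gamma (1 - α) =
          -((m / 4) ^ α * Real.Gamma (1 - α) / α) by ring] at h1
        refine h1.congr' ?_
        filter_upwards [self_mem_nhdsWithin] with r hr
        have hr' : 0 < r := hr
        simp only [Function.comp]
        rw [← rpow_mul_besselIntegral_neg (1 - α) (y := m * r ^ 2 / 4) (by positivity), neg_sub,
          show m * r ^ 2 / 4 = m / 4 * r ^ 2 by ring, Real.mul_rpow (by positivity) (by positivity)]
        have e1 : (m / 4) ^ (1 - α) = m / 4 / (m / 4) ^ α := by
          rw [Real.rpow_sub (by positivity), Real.rpow_one]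
        have e2 : (r ^ 2) ^ (1 - α) = r / r ^ (2 * α - 1) := by
          rw [← Real.rpow_natCast r 2, ← Real.rpow_mul hr'.le]
          nth_rewrite 2 [← Real.rpow_one r]
          rw [← Real.rpow_sub hr']
          congr 1
          push_cast
          ring
        have h3 := (Real.rpow_pos_of_pos hr' (2 * α - 1)).ne'
        have h4 := (Real.rpow_pos_of_pos (by positivity : 0 < m / 4) α).ne'
        rw [e1, e2]
        field_simp
    refine ((Complex.continuous_ofReal.tendsto _).comp hlim).congr' ?_
    filter_upwards [self_mem_nhdsWithin] with r hr
    have hr' : 0 < r := hr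
    have h1 := (Real.rpow_pos_of_pos hr' α).ne'
    simp only [Function.comp]
    rw [decayingSolution, ← Complex.ofReal_mul, ← Complex.ofReal_sub, ← Complex.ofReal_mul,
      Real.rpow_neg hr'.le, two_mul, Real.rpow_add hr', ← hαj]
    congr 1
    field_simp

/-! ### Regularity of domain elements -/

theorem acLoc_of_hasDerivAt {f f' : ℝ → ℂ} (hd : ∀ r : ℝ, 0 < r → HasDerivAt f (f' r) r)
    (hc : ContinuousOn f' (Ioi 0)) : ACLoc f := by
  have h1 : ContDiffOn ℝ 1 f (Ioi 0) := by
    rw [show (1 : WithTop ℕ∞) = 0 + 1 from (zero_add 1).symm,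
      contDiffOn_succ_iff_deriv_of_isOpen isOpen_Ioi]
    exact ⟨fun r hr => (hd r hr).differentiableAt.differentiableWithinAt, by simp,
      contDiffOn_zero.2 (hc.congr fun r hr => (hd r hr).deriv)⟩
  intro a b ha hab
  refine (h1.mono fun r hr => ?_).absolutelyContinuousOnInterval
  rw [uIcc_of_le hab] at hr
  exact ha.trans_le hr.1

/-- A locally absolutely continuous function whose derivative agrees almost everywhere with a
continuous function is continuously differentiable. -/
theorem ACLoc.hasDerivAt_of_ae_deriv_eq {f g : ℝ → ℂ} (hf : ACLoc f)
    (hg : ContinuousOn g (Ioi 0)) (hfg : ∀ᵐ r ∂radialMeasure, deriv f r = g r) {r : ℝ}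
    (hr : 0 < r) : HasDerivAt f (g r) r := by
  -- `f` minus the primitive of `g` is absolutely continuous with derivative `0` almost everywhere.
  have hprim : ∀ x : ℝ, 0 < x → HasDerivAt (fun x => ∫ t in r..x, g t) (g x) x := by
    intro x hx
    have hsub : uIcc r x ⊆ Ioi 0 := fun t ht => lt_of_lt_of_le (lt_min hr hx) ht.1
    exact intervalIntegral.integral_hasDerivAt_right (hg.mono hsub).intervalIntegrable
      (hg.stronglyMeasurableAtFilter isOpen_Ioi x hx) (hg.continuousAt (Ioi_mem_nhds hx))
  have hab : r / 2 ≤ 2 * r := by linarith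
  have hae : ∀ᵐ x, x ∈ uIcc (r / 2) (2 * r) →
      HasDerivAt (fun x => f x - ∫ t in r..x, g t) 0 x := by
    have h1 := (ae_radialMeasure_iff.1 (hfg.and hf.ae_differentiableAt))
    rw [ae_restrict_iff' measurableSet_Ioi] at h1
    filter_upwards [h1] with x hx hmem
    rw [uIcc_of_le hab] at hmem
    have hx0 : 0 < x := by linarith [hmem.1]
    obtain ⟨h2, h3⟩ := hx hx0
    refine (h3.hasDerivAt.sub (hprim x hx0)).congr_deriv ?_
    rw [h2, sub_self]
  obtain ⟨C, hC⟩ := ((hf (r / 2) (2 * r) (by linarith) hab).sub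
    (acLoc_of_hasDerivAt hprim hg (r / 2) (2 * r) (by linarith) hab)).const_of_ae_hasDerivAt_zero
    hae
  refine ((hprim r hr).const_add C).congr_of_eventuallyEq ?_
  filter_upwards [Icc_mem_nhds (by linarith : r / 2 < r) (by linarith : r < 2 * r)] with x hx
  rw [← hC x (by rwa [uIcc_of_le hab])]
  simp

theorem memLp_radialMeasure_iff {ψ : ℝ → ℂ} (hψ : ContinuousOn ψ (Ioi 0)) :
    MemLp ψ 2 radialMeasure ↔ IntegrableOn (fun r => r * ‖ψ r‖ ^ 2) (Ioi 0) := by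
  have hm : AEStronglyMeasurable ψ radialMeasure :=
    (hψ.aestronglyMeasurable measurableSet_Ioi).mono_ac (withDensity_absolutelyContinuous _ _)
  rw [memLp_two_iff_integrable_sq_norm hm, radialMeasure,
    integrable_withDensity_iff (by fun_prop) (by simp)]
  refine integrable_congr ?_
  filter_upwards [ae_restrict_mem measurableSet_Ioi] with r hr
  rw [ENNReal.toReal_ofReal (le_of_lt hr), mul_comm]

/-- An eigenfunction in the almost everywhere sense is a classical solution. -/
theorem InMaximalDomain.isRadialSolution {j : ℝ} {lam : ℂ} {ψ : ℝ → ℂ} (h : InMaximalDomain j ψ)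
    (he : radialExpr j ψ =ᵐ[radialMeasure] lam • ψ) :
    IsRadialSolution |j| lam ψ (fun r => (r : ℂ) * deriv ψ r) := by
  have hψc : ContinuousOn ψ (Ioi 0) := fun r hr =>
    (h.differentiableAt r hr).continuousAt.continuousWithinAt
  have hψ'c : ContinuousOn (deriv ψ) (Ioi 0) := by
    intro r hr
    have hr' : 0 < r := hr
    have := (h.acLoc_deriv (r / 2) (2 * r) (by linarith) (by linarith)).continuousOn
    rw [uIcc_of_le (by linarith)] at this
    exact (this.continuousAt
      (Icc_mem_nhds (by linarith) (by linarith))).continuousWithinAt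
  set g : ℝ → ℂ := fun r => -((1 / r : ℝ) : ℂ) * deriv ψ r + (((j ^ 2 / r ^ 2 : ℝ) : ℂ) - lam) * ψ r
  have hgc : ContinuousOn g (Ioi 0) := by
    have h1 : ContinuousOn (fun r : ℝ => ((1 / r : ℝ) : ℂ)) (Ioi 0) :=
      Complex.continuous_ofReal.comp_continuousOn
        (continuousOn_const.div continuousOn_id fun r hr => ne_of_gt hr)
    have h2 : ContinuousOn (fun r : ℝ => ((j ^ 2 / r ^ 2 : ℝ) : ℂ)) (Ioi 0) :=
      Complex.continuous_ofReal.comp_continuousOn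
        (continuousOn_const.div (continuousOn_id.pow 2) fun r hr => pow_ne_zero 2 (ne_of_gt hr))
    exact (h1.neg.mul hψ'c).add ((h2.sub continuousOn_const).mul hψc)
  have hd : ∀ r : ℝ, 0 < r → HasDerivAt (deriv ψ) (g r) r := by
    intro r hr
    refine h.acLoc_deriv.hasDerivAt_of_ae_deriv_eq hgc ?_ hr
    filter_upwards [he] with x hx
    simp only [radialExpr, Pi.smul_apply, smul_eq_mul] at hx
    simp only [g]
    linear_combination -hx
  refine ⟨fun r hr => ?_, fun r hr => ?_⟩
  · have hr' : (r : ℂ) ≠ 0 := by exact_mod_cast hr.ne'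
    rw [mul_div_cancel_left₀ _ hr']
    exact (h.differentiableAt r hr).hasDerivAt
  · have hr' : (r : ℂ) ≠ 0 := by exact_mod_cast hr.ne'
    refine ((hasDerivAt_id r).ofReal_comp.mul (hd r hr)).congr_deriv ?_
    rw [← Complex.ofReal_pow, sq_abs]
    simp only [g, id]
    push_cast
    field_simp
    ring

theorem IsRadialSolution.deriv_eq {α : ℝ} {lam : ℂ} {ψ u : ℝ → ℂ}
    (h : IsRadialSolution α lam ψ u) {r : ℝ} (hr : 0 < r) : deriv ψ r = u r / r :=
  (h.hasDerivAt r hr).deriv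

theorem IsRadialSolution.radialExpr_eq {j : ℝ} {lam : ℂ} {ψ u : ℝ → ℂ}
    (h : IsRadialSolution |j| lam ψ u) {r : ℝ} (hr : 0 < r) : radialExpr j ψ r = lam * ψ r := by
  have hr' : (r : ℂ) ≠ 0 := by exact_mod_cast hr.ne'
  have h1 := ((h.hasDerivAt_flux r hr).div (hasDerivAt_id r).ofReal_comp hr').deriv
  rw [radialExpr, deriv_congr_pos (fun x hx => h.deriv_eq hx) r hr, h.deriv_eq hr]
  erw [h1]
  rw [← Complex.ofReal_pow, sq_abs]
  simp only [id]
  push_cast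
  field_simp
  ring

theorem IsRadialSolution.inMaximalDomain {j : ℝ} {lam : ℂ} {ψ u : ℝ → ℂ}
    (h : IsRadialSolution |j| lam ψ u) (hψ : IntegrableOn (fun r => r * ‖ψ r‖ ^ 2) (Ioi 0)) :
    InMaximalDomain j ψ := by
  have hid : ContinuousOn (fun r : ℝ => (r : ℂ)) (Ioi 0) :=
    Complex.continuous_ofReal.continuousOn
  have hne : ∀ r ∈ Ioi (0 : ℝ), (r : ℂ) ≠ 0 := fun r hr => by
    exact_mod_cast ne_of_gt (mem_Ioi.1 hr)
  have hmem := (memLp_radialMeasure_iff h.continuousOn).2 hψ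
  refine ⟨fun r hr => (h.hasDerivAt r hr).differentiableAt,
    acLoc_of_hasDerivAt h.hasDerivAt (h.continuousOn_flux.div hid hne), ?_, hmem, ?_⟩
  · refine (acLoc_of_hasDerivAt (f := fun r => u r / (r : ℂ)) (fun r hr =>
      (h.hasDerivAt_flux r hr).div (hasDerivAt_id r).ofReal_comp (hne r hr)) ?_).congr
        fun r hr => (h.deriv_eq hr).symm
    have h1 : ContinuousOn (fun r : ℝ => (((|j| : ℝ) : ℂ) ^ 2 / (r : ℂ) - lam * (r : ℂ)) * ψ r)
        (Ioi 0) :=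
      ((continuousOn_const.div hid hne).sub (continuousOn_const.mul hid)).mul h.continuousOn
    exact ((h1.mul hid).sub (h.continuousOn_flux.mul continuousOn_const)).div (hid.pow 2)
      fun r hr => pow_ne_zero 2 (hne r hr)
  · refine (memLp_congr_ae ?_).2 (hmem.const_smul lam)
    refine ae_radialMeasure_iff.2 ?_
    filter_upwards [ae_restrict_mem measurableSet_Ioi] with r hr using h.radialExpr_eq hr

/-! ### The bound state spaces -/

/-- The bound state space in terms of functions, free of the choice of representatives made in the
definition of the operator. -/
theorem mem_boundStateSpace_iff {M j : ℝ} {ν : WithTop ℝ} {E : ℂ} {f : RadialL2} :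
    f ∈ boundStateSpace M j ν E ↔ ∃ ψ : ℝ → ℂ, InDomain j ν ψ ∧ f =ᵐ[radialMeasure] ψ ∧
      radialExpr j ψ =ᵐ[radialMeasure] (2 * (M : ℂ) * E) • ψ := by
  have key : ∀ x : (extension j ν).domain,
      (x ∈ LinearMap.ker ((extension j ν).toFun -
        (2 * (M : ℂ) * E) • (extension j ν).domain.subtype) ↔
      radialExpr j (rep x) =ᵐ[radialMeasure] (2 * (M : ℂ) * E) • rep x) := by
    intro x
    rw [LinearMap.mem_ker, LinearMap.sub_apply, sub_eq_zero, LinearMap.smul_apply]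
    change (rep_inDomain x).memLp_expr.toLp (radialExpr j (rep x)) =
      (2 * (M : ℂ) * E) • (x : RadialL2) ↔ _
    have h1 := (rep_inDomain x).memLp_expr.coeFn_toLp
    have h2 := (Lp.coeFn_smul (2 * (M : ℂ) * E) (x : RadialL2)).trans
      ((coeFn_ae_eq_rep x).const_smul (2 * (M : ℂ) * E))
    rw [Lp.ext_iff]
    exact ⟨fun h => (h1.symm.trans h).trans h2, fun h => (h1.trans h).trans h2.symm⟩
  rw [boundStateSpace, Submodule.mem_map]
  constructor
  · rintro ⟨x, hx, rfl⟩
    exact ⟨_, rep_inDomain x, coeFn_ae_eq_rep x, (key x).1 hx⟩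
  · rintro ⟨ψ, hψ, hf, he⟩
    let x : extensionDomain j ν := ⟨f, ψ, hψ, hf⟩
    refine ⟨x, (key x).2 ?_, rfl⟩
    exact ((radialExpr_rep_ae_eq x hψ hf).trans he).trans
      ((hf.symm.trans (coeFn_ae_eq_rep x)).const_smul _)

theorem memLp_decayingSolution {j m : ℝ} (hj0 : j ≠ 0) (hj1 : |j| < 1) (hm : 0 < m) :
    MemLp (decayingSolution |j| m) 2 radialMeasure :=
  (memLp_radialMeasure_iff (isRadialSolution_decayingSolution |j| hm).continuousOn).2
    (integrableOn_decayingSolution (abs_pos.2 hj0) hj1 hm)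

theorem BoundaryCondition.of_mul {ν : WithTop ℝ} {c c₀ c₁ : ℂ} (hc : c ≠ 0)
    (h : BoundaryCondition ν (c * c₀) (c * c₁)) : BoundaryCondition ν c₀ c₁ := by
  cases ν with
  | top => exact (mul_eq_zero.1 h).resolve_left hc
  | coe ν =>
    change (ν : ℂ) * (c * c₀) = c * c₁ at h
    change (ν : ℂ) * c₀ = c₁
    exact mul_left_cancel₀ hc (by linear_combination h)

/-- The boundary conditions are real: `Im (conj c₀ · c₁) = 0`. -/
theorem BoundaryCondition.re_mul_im_sub {ν : WithTop ℝ} {c₀ c₁ : ℂ}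
    (h : BoundaryCondition ν c₀ c₁) : c₀.re * c₁.im - c₀.im * c₁.re = 0 := by
  cases ν with
  | top =>
    change c₀ = 0 at h
    simp [h]
  | coe ν =>
    change (ν : ℂ) * c₀ = c₁ at h
    rw [← h, Complex.re_ofReal_mul, Complex.im_ofReal_mul]
    ring

/-- Every bound state has a spectral parameter `-m < 0` and is a multiple of the decaying solution,
which therefore satisfies the boundary condition. -/
theorem exists_of_mem_boundStateSpace {M j : ℝ} (hj0 : j ≠ 0) (hj1 : |j| < 1) {ν : WithTop ℝ}
    {E : ℂ} {f : RadialL2} (hf : f ∈ boundStateSpace M j ν E) (hf0 : f ≠ 0) :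
    ∃ m : ℝ, 0 < m ∧ 2 * (M : ℂ) * E = -(m : ℂ) ∧
      (∃ c : ℂ, f =ᵐ[radialMeasure] c • decayingSolution |j| m) ∧
      BoundaryCondition ν (Real.Gamma |j| : ℝ)
        (-((m / 4) ^ |j| * Real.Gamma (1 - |j|) / |j|) : ℝ) := by
  have hα := abs_pos.2 hj0
  obtain ⟨ψ, hψ, hfψ, he⟩ := mem_boundStateSpace_iff.1 hf
  obtain ⟨c₀, c₁, hb, hbc⟩ := hψ.boundary
  have hsol := hψ.isRadialSolution he
  have hint := (memLp_radialMeasure_iff hsol.continuousOn).1 hψ.memLp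
  have hne : ¬ ∀ r : ℝ, 0 < r → ψ r = 0 := by
    intro h0
    refine hf0 (Lp.ext (hfψ.trans (EventuallyEq.trans ?_ (Lp.coeFn_zero _ _ _).symm)))
    refine ae_radialMeasure_iff.2 ?_
    filter_upwards [ae_restrict_mem measurableSet_Ioi] with r hr using h0 r hr
  set lam := 2 * (M : ℂ) * E
  have him : lam.im = 0 := by
    by_contra h
    exact hne fun r hr => hsol.eq_zero_of_im_ne_zero hj0 hj1 hb hbc.re_mul_im_sub h hint hr
  have hlam : lam = (lam.re : ℂ) := Complex.ext rfl (by simp [him])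
  have hneg : lam.re < 0 := by
    rcases lt_trichotomy lam.re 0 with h | h | h
    · exact h
    · rw [hlam, h, Complex.ofReal_zero] at hsol
      exact absurd (fun r hr => hsol.eq_zero_of_zero hα hj1 hint hr) hne
    · rw [hlam] at hsol
      exact absurd (fun r hr => hsol.eq_zero_of_pos h hint hr) hne
  have hm : 0 < -lam.re := by linarith
  have hlam' : lam = -((-lam.re : ℝ) : ℂ) := by rw [Complex.ofReal_neg, neg_neg]; exact hlam
  have hK := isRadialSolution_decayingSolution |j| hm
  rw [← hlam'] at hK
  obtain ⟨c, hc⟩ := hsol.exists_eq_const_mul hK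
    (fun r hr => hsol.wronskian_eq_zero hint hK (integrableOn_decayingSolution hα hj1 hm) hr)
    (fun r hr => decayingSolution_ne_zero |j| hm hr)
  have hc0 : c ≠ 0 := by
    rintro rfl
    exact hne fun r hr => by rw [hc r hr, zero_mul]
  refine ⟨-lam.re, hm, hlam', ⟨c, hfψ.trans ?_⟩, ?_⟩
  · refine ae_radialMeasure_iff.2 ?_
    filter_upwards [ae_restrict_mem measurableSet_Ioi] with r hr using hc r hr
  · have hKb := (hasBoundaryValues_decayingSolution hj0 hj1 hm).smul c
    have h0 : c₀ = c * (Real.Gamma |j| : ℝ) := by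
      refine tendsto_nhds_unique hb.1 (hKb.1.congr' ?_)
      filter_upwards [self_mem_nhdsWithin] with r hr
      rw [hc r hr]
      rfl
    have h1 : c₁ = c * (-((-lam.re / 4) ^ |j| * Real.Gamma (1 - |j|) / |j|) : ℝ) := by
      refine tendsto_nhds_unique hb.2 (hKb.2.congr' ?_)
      filter_upwards [self_mem_nhdsWithin] with r hr
      rw [hc r hr, h0]
      rfl
    rw [h0, h1] at hbc
    exact hbc.of_mul hc0

theorem toLp_decayingSolution_mem {M j m : ℝ} (hj0 : j ≠ 0) (hj1 : |j| < 1) (hm : 0 < m)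
    {ν : WithTop ℝ} {E : ℂ} (hE : 2 * (M : ℂ) * E = -(m : ℂ))
    (hbc : BoundaryCondition ν (Real.Gamma |j| : ℝ)
      (-((m / 4) ^ |j| * Real.Gamma (1 - |j|) / |j|) : ℝ)) :
    (memLp_decayingSolution hj0 hj1 hm).toLp (decayingSolution |j| m) ∈
      boundStateSpace M j ν E := by
  have hK := isRadialSolution_decayingSolution |j| hm
  refine mem_boundStateSpace_iff.2 ⟨decayingSolution |j| m,
    ⟨hK.inMaximalDomain (integrableOn_decayingSolution (abs_pos.2 hj0) hj1 hm), _, _,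
      hasBoundaryValues_decayingSolution hj0 hj1 hm, hbc⟩, MemLp.coeFn_toLp _, ?_⟩
  rw [hE]
  refine ae_radialMeasure_iff.2 ?_
  filter_upwards [ae_restrict_mem measurableSet_Ioi] with r hr using hK.radialExpr_eq hr

theorem toLp_decayingSolution_ne_zero {j m : ℝ} (hj0 : j ≠ 0) (hj1 : |j| < 1) (hm : 0 < m) :
    (memLp_decayingSolution hj0 hj1 hm).toLp (decayingSolution |j| m) ≠ 0 := by
  intro h
  have h1 : decayingSolution |j| m =ᵐ[radialMeasure] 0 := 
    (MemLp.coeFn_toLp _).symm.trans ((Lp.ext_iff.1 h).trans (Lp.coeFn_zero _ _ _))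
  exact decayingSolution_ne_zero |j| hm one_pos
    (((isRadialSolution_decayingSolution |j| hm).inMaximalDomain
      (integrableOn_decayingSolution (abs_pos.2 hj0) hj1 hm)).eq_of_ae_eq
      (InDomain.zero j ⊤).toInMaximalDomain h1 1 one_pos)

/-- The boundary condition of the decaying solution fixes its decay rate. -/
theorem boundaryCondition_decayingSolution_iff {α m ν : ℝ} (hα0 : 0 < α) (hα1 : α < 1) :
    BoundaryCondition (ν : WithTop ℝ) (Real.Gamma α : ℝ)
        (-((m / 4) ^ α * Real.Gamma (1 - α) / α) : ℝ) ↔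
      (m / 4) ^ α = -ν * (Real.Gamma (1 + α) / Real.Gamma (1 - α)) := by
  have h1 : 0 < Real.Gamma (1 - α) := Real.Gamma_pos_of_pos (by linarith)
  change (ν : ℂ) * (Real.Gamma α : ℝ) = _ ↔ _
  rw [← Complex.ofReal_mul, Complex.ofReal_inj, add_comm 1 α, Real.Gamma_add_one hα0.ne']
  constructor <;> intro h
  · field_simp at h ⊢
    linarith
  · rw [h]
    field_simp

end RadialBG

theorem mainTheorem1 (M : ℝ) (hM : 0 < M) (j : ℝ) (hj0 : j ≠ 0) (hj1 : |j| < 1) :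
    (∀ ν : ℝ, ν < 0 → ∀ Eb : ℝ,
      Eb = -(2 / M) * (-ν * (Real.Gamma (1 + |j|) / Real.Gamma (1 - |j|))) ^ (1 / |j|) →
        RadialBG.boundStateEnergies M j (ν : WithTop ℝ) = {(Eb : ℂ)} ∧
        Module.finrank ℂ (RadialBG.boundStateSpace M j (ν : WithTop ℝ) (Eb : ℂ)) = 1) ∧
    (∀ ν : WithTop ℝ, 0 ≤ ν → RadialBG.boundStateEnergies M j ν = ∅) := by
  have hα : 0 < |j| := abs_pos.2 hj0
  have hG : 0 < Real.Gamma |j| := Real.Gamma_pos_of_pos hα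
  have hG1 : 0 < Real.Gamma (1 + |j|) := Real.Gamma_pos_of_pos (by linarith)
  have hG2 : 0 < Real.Gamma (1 - |j|) := Real.Gamma_pos_of_pos (by linarith)
  have hMc : (M : ℂ) ≠ 0 := by exact_mod_cast hM.ne'
  refine ⟨fun ν hν Eb hEb => ?_, fun ν hν => ?_⟩
  · set q := -ν * (Real.Gamma (1 + |j|) / Real.Gamma (1 - |j|)) with hq
    have hq0 : 0 < q := mul_pos (by linarith) (by positivity)
    set m := 4 * q ^ (1 / |j|) with hm
    have hm0 : 0 < m := by positivity
    have hmE : 2 * (M : ℂ) * (Eb : ℂ) = -(m : ℂ) := by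
      have : 2 * M * Eb = -m := by
        rw [hEb, hm]
        field_simp
        ring
      exact_mod_cast this
    have hbc := (RadialBG.boundaryCondition_decayingSolution_iff (m := m) (ν := ν) hα hj1).2 (by
      rw [hm, mul_div_cancel_left₀ _ (by norm_num : (4 : ℝ) ≠ 0), ← Real.rpow_mul hq0.le,
        one_div_mul_cancel hα.ne', Real.rpow_one])
    have huniq : ∀ m' : ℝ, 0 < m' → RadialBG.BoundaryCondition (ν : WithTop ℝ)
        (Real.Gamma |j| : ℝ) (-((m' / 4) ^ |j| * Real.Gamma (1 - |j|) / |j|) : ℝ) → m' = m := by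
      intro m' hm' h
      have h1 := (RadialBG.boundaryCondition_decayingSolution_iff hα hj1).1 h
      rw [hm, hq, ← h1, ← Real.rpow_mul (by positivity), mul_one_div_cancel hα.ne',
        Real.rpow_one]
      ring
    have hmem := RadialBG.toLp_decayingSolution_mem hj0 hj1 hm0 hmE hbc
    have hne := RadialBG.toLp_decayingSolution_ne_zero hj0 hj1 hm0
    set K := (RadialBG.memLp_decayingSolution hj0 hj1 hm0).toLp
      (RadialBG.decayingSolution |j| m) with hK
    refine ⟨Set.Subset.antisymm (fun E hE => ?_) (Set.singleton_subset_iff.2 ?_), ?_⟩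
    · obtain ⟨f, hf, hf0⟩ := (Submodule.ne_bot_iff _).1 hE
      obtain ⟨m', hm', hE', -, hbc'⟩ := RadialBG.exists_of_mem_boundStateSpace hj0 hj1 hf hf0
      rw [huniq m' hm' hbc', ← hmE] at hE'
      exact mul_left_cancel₀ (mul_ne_zero two_ne_zero hMc) hE'
    · exact (Submodule.ne_bot_iff _).2 ⟨K, hmem, hne⟩
    · have hspan : RadialBG.boundStateSpace M j (ν : WithTop ℝ) (Eb : ℂ) = ℂ ∙ K := by
        refine le_antisymm (fun f hf => ?_)
          ((Submodule.span_singleton_le_iff_mem _ _).2 hmem)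
        by_cases hf0 : f = 0
        · rw [hf0]
          exact Submodule.zero_mem _
        obtain ⟨m', hm', -, ⟨c, hc⟩, hbc'⟩ :=
          RadialBG.exists_of_mem_boundStateSpace hj0 hj1 hf hf0
        rw [huniq m' hm' hbc'] at hc
        refine Submodule.mem_span_singleton.2 ⟨c, Lp.ext ?_⟩
        exact ((Lp.coeFn_smul c K).trans ((MemLp.coeFn_toLp _).const_smul c)).trans hc.symm
      rw [hspan]
      exact finrank_span_singleton hne
  · refine Set.eq_empty_iff_forall_notMem.2 fun E hE => ?_
    obtain ⟨f, hf, hf0⟩ := (Submodule.ne_bot_iff _).1 hE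
    obtain ⟨m, hm, -, -, hbc⟩ := RadialBG.exists_of_mem_boundStateSpace hj0 hj1 hf hf0
    cases ν with
    | top =>
      change ((Real.Gamma |j| : ℝ) : ℂ) = 0 at hbc
      exact hG.ne' (by exact_mod_cast hbc)
    | coe ν =>
      have h1 := (RadialBG.boundaryCondition_decayingSolution_iff hα hj1).1 hbc
      have h2 : 0 ≤ ν := by exact_mod_cast hν
      have h3 : 0 < (m / 4) ^ |j| := by positivity
      have h4 : 0 ≤ ν * (Real.Gamma (1 + |j|) / Real.Gamma (1 - |j|)) := by positivity
      linarith
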